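/- Let $p>q\ge 2$ be integers and, for $c\in\mathbb C$, let $\mathbf f_c$ be the correspondence on $\mathbb C$ that relates $z$ to every $w$ with $(w-c)^q=z^p$ (such a $w$ is called an image of $z$). A forward orbit is a sequence $(z_i)_{i\ge 0}$ in which each $z_{i+1}$ is an image of $z_i$. If $w$ is an image of $z\ne 0$, let $g_{z,w}$ be the local univalent branch of $\mathbf f_c$ with $g_{z,w}(z)=w$; then $g_{z,w}'(z)=p(w-c)/(qz)$. A finite orbit $(z_0,\dots,z_n)$, $n\ge 1$, avoiding $0$, with $z_n=z_0$ and $z_i\neq z_0$ for $0<i<n$, is a repelling cycle if $\prod_{i<n}|g_{z_i,z_{i+1}}'(z_i)|>1$. The Julia set $J(\mathbf f_c)$ is the closure of the union of all repelling cycles. Let $X_c\subset\mathbb C^{\mathbb N}$ be the space of all forward orbits contained in $J(\mathbf f_c)$, with the product topology and the left shift $\sigma$, let $\varphi_c((z_i)_i)=-\log|g_{z_0,z_1}'(z_0)|$, and let $P(t\varphi_c)$ be the topological pressure of $t\varphi_c$ with respect to $\sigma$ on $X_c$. When the function $t\mapsto P(t\varphi_c)$ has exactly one zero on $[0,\infty)$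 and this zero is positive, it is called the Bowen parameter $t_c$. A parameter $a$ is a simple centre if precisely one forward orbit of $0$ under $\mathbf f_a$ is periodic and all other forward orbits of $0$ diverge to infinity. (i) Every simple centre $a$ has a neighbourhood such that for every $c$ in it the Bowen parameter $t_c$ exists and $\dim_H J(\mathbf f_c)\le t_c$. (ii) If every forward orbit of $0$ under $\mathbf f_c$ diverges to infinity, or if no forward orbit of $0$ under $\mathbf f_c$ is bounded (that is, $c\notin\mathcal M_{\beta,0}$, $\beta=p/q$), then the Bowen parameter $t_c$ exists and $\dim_H J(\mathbf f_c)\le t_c$. -/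

import Mathlib

open Filter Topology Uniformity

noncomputable section

/-- Topological pressure of the potential `φ` for the map `T` on the (invariant, compact) set `F`,
defined through separated sets:
`P(φ) = sup_U limsup_n (1/n) log sup_E ∑_{x ∈ E} exp (S_n φ (x))`,
where `U` runs over the entourages, `E` over the finite `(U, n)`-separated subsets of `F`, and
`S_n φ` is the Birkhoff sum. -/
def topologicalPressure {X : Type*} [UniformSpace X] (T : X → X) (F : Set X) (φ : X → ℝ) :
    EReal :=
  ⨆ U ∈ 𝓤 X, ExpGrowth.expGrowthSup fun n : ℕ ↦
    ⨆ (E : Finset X) (_ : Dynamics.IsDynNetIn T F U n (E : Set X)),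
      ∑ x ∈ E, ENNReal.ofReal (Real.exp (birkhoffSum T φ n x))

/-- The pressure of the zero potential is the topological entropy. -/
theorem topologicalPressure_zero {X : Type*} [UniformSpace X] (T : X → X) (F : Set X) :
    topologicalPressure T F (fun _ ↦ 0) = Dynamics.coverEntropy T F := by
  rw [Dynamics.coverEntropy_eq_iSup_netEntropyEntourage]
  refine iSup_congr fun U ↦ iSup_congr fun _ ↦ ?_
  unfold Dynamics.netEntropyEntourage
  congr 1
  funext n
  simp [birkhoffSum, Dynamics.netMaxcard, ENat.toENNReal_iSup]

namespace Correspondence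

/-- `w` is an image of `z` under the correspondence `𝐟_c : (w - c) ^ q = z ^ p`. -/
def IsImage (p q : ℕ) (c z w : ℂ) : Prop := (w - c) ^ q = z ^ p

/-- An infinite forward orbit `z 0 ↦ z 1 ↦ z 2 ↦ ⋯`. -/
def IsOrbit (p q : ℕ) (c : ℂ) (z : ℕ → ℂ) : Prop := ∀ i, IsImage p q c (z i) (z (i + 1))

/-- The derivative at `z ≠ 0` of the univalent branch `g` of the correspondence with `g z = w`;
see `hasDerivAt_branch`. -/
def branchDeriv (p q : ℕ) (c z w : ℂ) : ℂ := p * (w - c) / (q * z)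

/-- Every local branch of the correspondence at a point `z ≠ 0` has the derivative
`branchDeriv p q c z (g z)` there. -/
theorem hasDerivAt_branch {p q : ℕ} (hq : q ≠ 0) {c z : ℂ} (hz : z ≠ 0) {g : ℂ → ℂ}
    (hg : DifferentiableAt ℂ g z) (h : ∀ᶠ ζ in 𝓝 z, IsImage p q c ζ (g ζ)) :
    HasDerivAt g (branchDeriv p q c z (g z)) z := by
  have h0 : (g z - c) ^ q = z ^ p := h.self_of_nhds
  have hw : g z - c ≠ 0 := by
    intro hw
    rw [hw, zero_pow hq] at h0
    exact pow_ne_zero p hz h0.symm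
  have h1 := (hg.hasDerivAt.sub_const c).pow q
  have h2 : HasDerivAt (fun ζ ↦ ζ ^ p) (q * (g z - c) ^ (q - 1) * deriv g z) z := by
    refine h1.congr_of_eventuallyEq ?_
    filter_upwards [h] with ζ hζ
    exact hζ.symm
  have h3 := h2.unique (hasDerivAt_pow p z)
  have hq' : (q : ℂ) ≠ 0 := by exact_mod_cast hq
  have h4 : deriv g z = branchDeriv p q c z (g z) := by
    rw [branchDeriv, eq_div_iff (mul_ne_zero hq' hz)]
    have hpow : (g z - c) ^ (q - 1) ≠ 0 := pow_ne_zero _ hw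
    apply mul_left_cancel₀ hpow
    have e1 : (g z - c) ^ (q - 1) * (g z - c) = (g z - c) ^ q := pow_sub_one_mul hq _
    have e2 : (p : ℂ) * z ^ (p - 1) * z = p * z ^ p := by
      rcases Nat.eq_zero_or_pos p with rfl | hp
      · simp
      · rw [mul_assoc, pow_sub_one_mul hp.ne']
    calc (g z - c) ^ (q - 1) * (deriv g z * (q * z))
        = (q * (g z - c) ^ (q - 1) * deriv g z) * z := by ring
      _ = p * z ^ p := by rw [h3, e2]
      _ = (g z - c) ^ (q - 1) * (p * (g z - c)) := by rw [← h0, ← e1]; ring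
  exact h4 ▸ hg.hasDerivAt

/-- `(z 0, …, z n)` is a repelling cycle of period `n`: a finite orbit avoiding `0` that returns to
`z 0` for the first time at time `n`, such that the composition `g` of the branches along the
cycle, whose derivative is the product of the derivatives of the branches, has `|g' (z 0)| > 1`. -/
def IsRepellingCycle (p q : ℕ) (c : ℂ) (n : ℕ) (z : ℕ → ℂ) : Prop :=
  0 < n ∧ (∀ i < n, IsImage p q c (z i) (z (i + 1))) ∧ z n = z 0 ∧
    (∀ i, 0 < i → i < n → z i ≠ z 0) ∧ (∀ i < n, z i ≠ 0) ∧
    1 < ‖∏ i ∈ Finset.range n, branchDeriv p q c (z i) (z (i + 1))‖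

/-- The Julia set `J(𝐟_c)`: the closure of the union of all repelling cycles. -/
def juliaSet (p q : ℕ) (c : ℂ) : Set ℂ :=
  closure {ζ | ∃ n z, IsRepellingCycle p q c n z ∧ ∃ i < n, z i = ζ}

/-- `c` is a simple centre: precisely one forward orbit of the critical point `0` is periodic, and
all the others diverge to infinity. -/
def IsSimpleCentre (p q : ℕ) (c : ℂ) : Prop :=
  ∃ z : ℕ → ℂ, IsOrbit p q c z ∧ z 0 = 0 ∧ (∃ n > 0, Function.Periodic z n) ∧
    ∀ w : ℕ → ℂ, IsOrbit p q c w → w 0 = 0 → w ≠ z → Tendsto w atTop (Bornology.cobounded ℂ)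

/-- The set `M_{β,0}` of the parameters for which `0` has at least one bounded forward orbit. -/
def boundedCriticalLocus (p q : ℕ) : Set ℂ :=
  {c | ∃ z : ℕ → ℂ, IsOrbit p q c z ∧ z 0 = 0 ∧ Bornology.IsBounded (Set.range z)}

/-- The space `X_c` of all forward orbits contained in the Julia set. It is regarded as a subspace
of the product space `ℂ^ℕ`. -/
def orbitSpace (p q : ℕ) (c : ℂ) : Set (ℕ → ℂ) :=
  {z | IsOrbit p q c z ∧ ∀ i, z i ∈ juliaSet p q c}

/-- The left shift on sequences. -/
def shift (z : ℕ → ℂ) : ℕ → ℂ := fun i ↦ z (i + 1)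

/-- The geometric potential `φ_c = -log |g'(z 0)|`, where `g` is the branch with
`g (z 0) = z 1`. -/
def geometricPotential (p q : ℕ) (c : ℂ) (z : ℕ → ℂ) : ℝ :=
  -Real.log ‖branchDeriv p q c (z 0) (z 1)‖

/-- The pressure function `t ↦ P(t φ_c)` of the shift on the orbit space `X_c`. -/
def pressureFunction (p q : ℕ) (c : ℂ) (t : ℝ) : EReal :=
  topologicalPressure shift (orbitSpace p q c) fun z ↦ t * geometricPotential p q c z

/-- `t` is the Bowen parameter `t_c`: it is positive and it is the unique zero of the pressure
function on `[0, ∞)`. -/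
def IsBowenParameter (p q : ℕ) (c : ℂ) (t : ℝ) : Prop :=
  0 < t ∧ ∀ s : ℝ, 0 ≤ s → (pressureFunction p q c s = 0 ↔ s = t)

end Correspondence

end

/-!
Call a bounded open set `U` trapping if it contains the repelling cycles, omits the critical value
and contains the `ε`-neighbourhood of its own preimage. A holomorphic disc in `U` lifts along the
correspondence to a disc in the preimage, which the `ε` of room allows to enlarge by a definite
factor within `U`. Since discs in the bounded set `U` have bounded derivative, the multipliers of
long orbits grow exponentially.

Every point of a minimal compact backward invariant set is a limit of its own preimages, hence, by
the closing lemma, a limit of repelling cycles. So the Julia set contains a nonempty backward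
invariant set, and the `p` distinct preimages of each of its points produce positive entropy.
Expansion makes the shift on `X_c` expansive, so that the entropy is also finite. The Birkhoff sums
of `φ_c` lie between two negative multiples of `n`, up to constants, so that `t ↦ P(t φ_c)`
decreases at definite rates from `P(0) > 0` and has exactly one zero. For `t` to the right of it,
`P(t φ_c) < 0` and bounded distortion yield covers of the Julia set whose `t`-th powers of
diameters have bounded sums, so that the dimension is at most `t`.

If no forward orbit of the critical point is bounded, an iterated preimage of a large disc is
trapping. Near a simple centre one removes from it small discs around the periodic critical orbit,
which are absorbing because the branches are superattracting at `0`.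
-/

open Metric

/-! ### Roots, discs and periodic products -/

theorem exists_pow_eq_norm_sub_pow_le {p : ℕ} (hp : p ≠ 0) (A z : ℂ) :
    ∃ u : ℂ, u ^ p = A ∧ ‖z - u‖ ^ p ≤ ‖z ^ p - A‖ := by
  have hp0 := Nat.pos_of_ne_zero hp
  obtain ⟨u₀, rfl⟩ := IsAlgClosed.exists_pow_nat_eq A hp0
  have hprim := Complex.isPrimitiveRoot_exp p hp
  have hne : (Polynomial.nthRootsFinset p (1 : ℂ)).Nonempty := by
    rwa [← Finset.card_pos, hprim.card_nthRootsFinset]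
  obtain ⟨ζ, hζ, hmin⟩ := Finset.exists_min_image _ (fun ζ ↦ ‖z - ζ * u₀‖) hne
  refine ⟨ζ * u₀, ?_, ?_⟩
  · rw [mul_pow, (Polynomial.mem_nthRootsFinset hp0 _).1 hζ, one_mul]
  · calc ‖z - ζ * u₀‖ ^ p
        = ∏ _η ∈ Polynomial.nthRootsFinset p (1 : ℂ), ‖z - ζ * u₀‖ := by
          rw [Finset.prod_const, hprim.card_nthRootsFinset]
      _ ≤ ∏ η ∈ Polynomial.nthRootsFinset p (1 : ℂ), ‖z - η * u₀‖ :=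
          Finset.prod_le_prod (fun _ _ ↦ norm_nonneg _) hmin
      _ = ‖z ^ p - u₀ ^ p‖ := by rw [hprim.pow_sub_pow_eq_prod_sub_mul z u₀ hp0, norm_prod]

theorem exists_eqOn_ball_mul_exp {f : ℂ → ℂ} {z : ℂ} {r : ℝ} (hr : 0 < r)
    (hf : DifferentiableOn ℂ f (ball z r)) (hf0 : ∀ ζ ∈ ball z r, f ζ ≠ 0) :
    ∃ g : ℂ → ℂ, DifferentiableOn ℂ g (ball z r) ∧ g z = 0 ∧
      Set.EqOn f (fun ζ ↦ f z * Complex.exp (g ζ)) (ball z r) := by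
  obtain ⟨g, hgz, hg⟩ := ((hf.deriv isOpen_ball).div hf hf0).isExactOn_ball.with_val_at z 0
  have hgd : DifferentiableOn ℂ g (ball z r) := fun ζ hζ ↦
    (hg ζ hζ).differentiableAt.differentiableWithinAt
  have hlog : Set.EqOn (logDeriv f) (logDeriv fun ζ ↦ Complex.exp (g ζ)) (ball z r) := by
    intro ζ hζ
    rw [logDeriv_apply, logDeriv_apply, (hg ζ hζ).cexp.deriv,
      mul_div_cancel_left₀ _ (Complex.exp_ne_zero _)]
    rfl
  obtain ⟨a, -, ha⟩ := (logDeriv_eqOn_iff hf hgd.cexp isOpen_ball (convex_ball z r).isPreconnected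
    (fun _ _ ↦ Complex.exp_ne_zero _) hf0).1 hlog
  have haz : f z = a := by simpa [hgz] using ha (mem_ball_self hr)
  exact ⟨g, hgd, hgz, fun ζ hζ ↦ by rw [haz]; exact ha hζ⟩

theorem dist_add_ofReal_mul {d : ℝ} (hd : 0 ≤ d) (z ζ : ℂ) : dist (z + d * ζ) z = d * ‖ζ‖ := by
  rw [dist_eq_norm, add_sub_cancel_left, norm_mul, Complex.norm_of_nonneg hd]

theorem mapsTo_add_ofReal_mul_unitBall {d : ℝ} (hd : 0 < d) (z : ℂ) :
    Set.MapsTo (fun ζ : ℂ ↦ z + d * ζ) (ball 0 1) (ball z d) := fun ζ hζ ↦ by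
  rw [mem_ball, dist_add_ofReal_mul hd.le]
  exact mul_lt_of_lt_one_right hd (mem_ball_zero_iff.1 hζ)

/-- The function `ζ ↦ (f ζ - a) / δ` is a contraction of the disc of radius `1 / 2`. -/
theorem exists_eq_add_mul_of_norm_deriv_le {f : ℂ → ℂ} {a : ℂ} {δ : ℝ} (hδ : 0 < δ)
    (hf : ∀ ζ ∈ closedBall (0 : ℂ) (1 / 2), DifferentiableAt ℂ f ζ)
    (hder : ∀ ζ ∈ closedBall (0 : ℂ) (1 / 2), ‖deriv f ζ‖ ≤ δ / 2) (ha : dist (f 0) a ≤ δ / 4) :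
    ∃ ζ ∈ closedBall (0 : ℂ) (1 / 2), f ζ = a + δ * ζ := by
  have hδ' : (δ : ℂ) ≠ 0 := by exact_mod_cast hδ.ne'
  have hlip : ∀ ζ ∈ closedBall (0 : ℂ) (1 / 2), ∀ ξ ∈ closedBall (0 : ℂ) (1 / 2),
      ‖f ξ - f ζ‖ ≤ δ / 2 * ‖ξ - ζ‖ := fun ζ hζ ξ hξ ↦
    (convex_closedBall (0 : ℂ) (1 / 2)).norm_image_sub_le_of_norm_deriv_le hf hder hζ hξ
  set T : ℂ → ℂ := fun ζ ↦ (f ζ - a) / δ with hT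
  have hmaps : Set.MapsTo T (closedBall 0 (1 / 2)) (closedBall 0 (1 / 2)) := by
    intro ζ hζ
    have hl := hlip 0 (by simp) ζ hζ
    rw [mem_closedBall_zero_iff, norm_div, Complex.norm_of_nonneg hδ.le, div_le_iff₀ hδ]
    rw [mem_closedBall_zero_iff] at hζ
    rw [dist_eq_norm] at ha
    rw [sub_zero] at hl
    calc ‖f ζ - a‖ ≤ ‖f ζ - f 0‖ + ‖f 0 - a‖ := norm_sub_le_norm_sub_add_norm_sub _ _ _
      _ ≤ δ / 2 * (1 / 2) + δ / 4 := add_le_add (hl.trans (by gcongr)) ha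
      _ = 1 / 2 * δ := by ring
  have hcontr : ContractingWith (1 / 2) (hmaps.restrict T _ _) := by
    refine ⟨by norm_num, LipschitzWith.of_dist_le_mul fun ζ ξ ↦ ?_⟩
    change dist (T ζ) (T ξ) ≤ _ * dist (ζ : ℂ) ξ
    rw [dist_eq_norm, dist_eq_norm, ← sub_div, sub_sub_sub_cancel_right, norm_div,
      Complex.norm_of_nonneg hδ.le, div_le_iff₀ hδ]
    refine (hlip ξ ξ.2 ζ ζ.2).trans (le_of_eq ?_)
    push_cast
    ring
  obtain ⟨ζ, hζ, hfix, -, -⟩ := hcontr.exists_fixedPoint' isClosed_closedBall.isComplete hmaps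
    (x := 0) (by simp) (edist_ne_top _ _)
  have hfix : (f ζ - a) / δ = ζ := hfix
  rw [div_eq_iff hδ'] at hfix
  exact ⟨ζ, hζ, by linear_combination hfix⟩

theorem prod_range_mul_of_periodic {M : Type*} [CommMonoid M] {f : ℕ → M} {m : ℕ}
    (hf : Function.Periodic f m) (k : ℕ) :
    ∏ i ∈ Finset.range (k * m), f i = (∏ i ∈ Finset.range m, f i) ^ k := by
  induction k with
  | zero => simp
  | succ k ih =>
    rw [Nat.succ_mul, Finset.prod_range_add, ih, pow_succ]
    congr 1
    exact Finset.prod_congr rfl fun i _ ↦ by rw [add_comm]; exact hf.nat_mul k i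

theorem apply_add_one_mod {α : Type*} {z : ℕ → α} {n : ℕ} (h0 : 0 < n) (hn : z n = z 0) (i : ℕ) :
    z ((i + 1) % n) = z (i % n + 1) := by
  rw [← Nat.mod_add_mod]
  rcases (show i % n + 1 ≤ n from Nat.mod_lt i h0).lt_or_eq with h | h
  · rw [Nat.mod_eq_of_lt h]
  · rw [h, Nat.mod_self, hn]

/-! ### Closed relations and recurrence -/

theorem isClosed_setOf_exists_mem_of_isCompact {X Y : Type*} [TopologicalSpace X]
    [TopologicalSpace Y] {K : Set Y} (hK : IsCompact K) {C : Set (X × Y)} (hC : IsClosed C) :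
    IsClosed {x | ∃ y ∈ K, (x, y) ∈ C} := by
  have : CompactSpace K := isCompact_iff_compactSpace.1 hK
  have h : IsClosed {z : X × K | (z.1, (z.2 : Y)) ∈ C} := hC.preimage (by fun_prop)
  convert isClosedMap_fst_of_compactSpace _ h using 1
  ext x
  simp

theorem exists_minimal_isClosed_map_subset {X : Type*} [TopologicalSpace X] {f : Set X → Set X}
    (hf : Monotone f) {K : Set X} (hK : IsCompact K) (hKcl : IsClosed K) (hKne : K.Nonempty)
    (hKf : f K ⊆ K) :
    ∃ Λ ⊆ K, Minimal (fun A ↦ IsClosed A ∧ A.Nonempty ∧ f A ⊆ A) Λ := by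
  have hlower : ∀ C ⊆ {A | A ⊆ K ∧ IsClosed A ∧ A.Nonempty ∧ f A ⊆ A}, IsChain (· ⊆ ·) C →
      C.Nonempty → ⋂₀ C ∈ {A | A ⊆ K ∧ IsClosed A ∧ A.Nonempty ∧ f A ⊆ A} := by
    rintro C hC hchain ⟨A₀, hA₀⟩
    have : Nonempty C := ⟨⟨A₀, hA₀⟩⟩
    refine ⟨(Set.sInter_subset_of_mem hA₀).trans (hC hA₀).1,
      isClosed_sInter fun A hA ↦ (hC hA).2.1, ?_, Set.subset_sInter fun A hA ↦
        (hf (Set.sInter_subset_of_mem hA)).trans (hC hA).2.2.2⟩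
    rw [Set.sInter_eq_iInter]
    exact IsCompact.nonempty_iInter_of_directed_nonempty_isCompact_isClosed _
      (fun A B ↦ (hchain.total A.2 B.2).elim (fun h ↦ ⟨A, subset_rfl, h⟩)
        fun h ↦ ⟨B, h, subset_rfl⟩)
      (fun A ↦ (hC A.2).2.2.1) (fun A ↦ hK.of_isClosed_subset (hC A.2).2.1 (hC A.2).1)
      fun A ↦ (hC A.2).2.1
  obtain ⟨Λ, hΛK, hΛ⟩ := zorn_superset_nonempty _
    (fun C hC hchain hne ↦ ⟨⋂₀ C, hlower C hC hchain hne, fun _ ↦ Set.sInter_subset_of_mem⟩)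
    K ⟨subset_rfl, hKcl, hKne, hKf⟩
  exact ⟨Λ, hΛK, hΛ.prop.2, fun A hA hAΛ ↦ hΛ.le_of_le ⟨hAΛ.trans hΛK, hA⟩ hAΛ⟩

/-- In a minimal closed backward invariant set every point is in the closure of its own remote
preimages, since that closure is again backward invariant. -/
theorem exists_backwardInvariant_recurrent {X : Type*} [TopologicalSpace X] {r : SetRel X X}
    (hcod : r.cod = Set.univ) (hcl : ∀ S, r.preimage (closure S) ⊆ closure (r.preimage S))
    {K : Set X} (hK : IsCompact K) (hKcl : IsClosed K) (hKne : K.Nonempty)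
    (hKr : r.preimage K ⊆ K) :
    ∃ Λ ⊆ K, Λ.Nonempty ∧ r.preimage Λ ⊆ Λ ∧
      ∀ z ∈ Λ, ∀ N : ℕ, z ∈ closure (⋃ n ≥ N, r.preimage^[n] {z}) := by
  have hmono : Monotone r.preimage := fun _ _ h ↦ r.preimage_mono h
  obtain ⟨Λ, hΛK, hΛ⟩ := exists_minimal_isClosed_map_subset hmono hK hKcl hKne hKr
  obtain ⟨hΛcl, hΛne, hΛr⟩ := hΛ.prop
  refine ⟨Λ, hΛK, hΛne, hΛr, fun z hz N ↦ ?_⟩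
  set S := ⋃ n ≥ N, r.preimage^[n] {z}
  have hSΛ : S ⊆ Λ := Set.iUnion₂_subset fun n _ ↦
    (hmono.iterate n (Set.singleton_subset_iff.2 hz)).trans
      (hmono.antitone_iterate_of_map_le hΛr (Nat.zero_le n))
  have hSr : r.preimage S ⊆ S := by
    simp only [S, SetRel.preimage_iUnion, ← Function.iterate_succ_apply']
    exact Set.iUnion₂_subset fun n hn ↦
      Set.subset_iUnion₂_of_subset (n + 1) (Nat.le_succ_of_le hn) subset_rfl
  have hSne : S.Nonempty := by
    have hiter : ∀ n, (r.preimage^[n] {z}).Nonempty := fun n ↦ by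
      induction n with
      | zero => exact Set.singleton_nonempty z
      | succ n ih =>
        obtain ⟨y, hy⟩ := ih
        obtain ⟨x, hxy⟩ := r.mem_cod.1 (hcod ▸ Set.mem_univ y)
        exact ⟨x, by rw [Function.iterate_succ_apply']; exact ⟨y, hy, hxy⟩⟩
    exact (hiter N).mono (Set.subset_iUnion₂_of_subset N le_rfl subset_rfl)
  exact hΛ.le_of_le ⟨isClosed_closure, hSne.closure, (hcl S).trans (closure_mono hSr)⟩
    (closure_minimal hSΛ hΛcl) hz

/-! ### Topological pressure -/

section Pressure

open Dynamics ExpGrowth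

open scoped SetRel

variable {X : Type*} {T : X → X} {F : Set X} {V : SetRel X X}

/-- The partition function `Z_n(φ)` at scale `V`, whose exponential growth rate the topological
pressure measures. -/
noncomputable def partitionFunction (T : X → X) (F : Set X) (φ : X → ℝ) (V : SetRel X X) (n : ℕ) :
    ENNReal :=
  ⨆ (E : Finset X) (_ : IsDynNetIn T F V n (E : Set X)),
    ∑ x ∈ E, ENNReal.ofReal (Real.exp (birkhoffSum T φ n x))

theorem sum_le_partitionFunction {φ : X → ℝ} {n : ℕ} {E : Finset X}
    (hE : IsDynNetIn T F V n (E : Set X)) :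
    ∑ x ∈ E, ENNReal.ofReal (Real.exp (birkhoffSum T φ n x)) ≤ partitionFunction T F φ V n :=
  le_iSup₂_of_le E hE le_rfl

theorem partitionFunction_le_mul {φ ψ : X → ℝ} {n : ℕ} {a : ℝ}
    (h : ∀ x ∈ F, birkhoffSum T φ n x ≤ birkhoffSum T ψ n x + a) :
    partitionFunction T F φ V n ≤
      ENNReal.ofReal (Real.exp a) * partitionFunction T F ψ V n := by
  refine iSup₂_le fun E hE ↦ ?_
  calc ∑ x ∈ E, ENNReal.ofReal (Real.exp (birkhoffSum T φ n x))
      ≤ ∑ x ∈ E, ENNReal.ofReal (Real.exp a) *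
          ENNReal.ofReal (Real.exp (birkhoffSum T ψ n x)) := by
        refine Finset.sum_le_sum fun x hx ↦ ?_
        rw [← ENNReal.ofReal_mul (Real.exp_pos _).le, ← Real.exp_add, add_comm a]
        gcongr
        exact h x (hE.1 hx)
    _ ≤ ENNReal.ofReal (Real.exp a) * partitionFunction T F ψ V n := by
        rw [← Finset.mul_sum]
        gcongr
        exact sum_le_partitionFunction hE

theorem exists_isDynNetIn_isDynCoverOf [V.IsRefl] [V.IsSymm] {n : ℕ}
    (h : netMaxcard T F V n < ⊤) :
    ∃ E : Finset X, IsDynNetIn T F V n (E : Set X) ∧ IsDynCoverOf T F (V ○ V) n (E : Set X) := by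
  classical
  obtain ⟨E, hE, hcard⟩ := (netMaxcard_finite_iff T F V n).1 h
  refine ⟨E, hE, fun x hx ↦ ?_⟩
  by_contra! hfar
  have hxE : x ∉ E := fun hxE ↦ hfar x hxE (mem_dynEntourage.2 fun k _ ↦
    SetRel.prodMk_mem_comp (SetRel.rfl V) (SetRel.rfl V))
  have hnet : IsDynNetIn T F V n ((insert x E : Finset X) : Set X) := by
    rw [Finset.coe_insert]
    refine ⟨Set.insert_subset hx hE.1, hE.2.insert fun e he _ ↦ ?_⟩
    exact Set.disjoint_left.2 fun u hux hue ↦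
      hfar e he (mem_ball_dynEntourage_comp T n e x ⟨u, hue, hux⟩)
  have hle := hnet.card_le_netMaxcard
  rw [Finset.card_insert_of_notMem hxE, ← hcard] at hle
  exact (Nat.lt_succ_self E.card).not_ge (mod_cast hle)

variable [UniformSpace X]

theorem expGrowthSup_partitionFunction_le (hV : V ∈ 𝓤 X) (φ : X → ℝ) :
    expGrowthSup (partitionFunction T F φ V) ≤ topologicalPressure T F φ :=
  le_iSup₂_of_le (f := fun V (_ : V ∈ 𝓤 X) ↦ expGrowthSup (partitionFunction T F φ V)) V hV le_rfl

theorem eventually_partitionFunction_le_exp (hV : V ∈ 𝓤 X) {φ : X → ℝ} {b : ℝ}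
    (h : topologicalPressure T F φ < b) :
    ∀ᶠ n : ℕ in atTop, partitionFunction T F φ V n ≤ ENNReal.ofReal (Real.exp (b * n)) := by
  filter_upwards [eventually_le_exp ((expGrowthSup_partitionFunction_le hV φ).trans_lt h)]
    with n hn
  rwa [show (b : EReal) * n = ((b * n : ℝ) : EReal) from (EReal.coe_mul b n).symm,
    EReal.exp_coe] at hn

theorem topologicalPressure_le_add {φ ψ : X → ℝ} {a b : ℝ}
    (h : ∀ x ∈ F, ∀ n : ℕ, birkhoffSum T φ n x ≤ birkhoffSum T ψ n x + (a * n + b)) :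
    topologicalPressure T F φ ≤ topologicalPressure T F ψ + a := by
  refine iSup₂_le fun V hV ↦ ?_
  set w : ℕ → ENNReal := fun n ↦ EReal.exp ((a : EReal) * n)
  have hw : expGrowthSup w = a := expGrowthSup_exp
  have hZ (n : ℕ) : partitionFunction T F φ V n ≤
      ENNReal.ofReal (Real.exp b) * (w * partitionFunction T F ψ V) n := by
    have hwn : w n = ENNReal.ofReal (Real.exp (a * n)) := by
      rw [← EReal.exp_coe, EReal.coe_mul]
      rfl
    rw [Pi.mul_apply, hwn, ← mul_assoc, ← ENNReal.ofReal_mul (Real.exp_pos _).le, ← Real.exp_add,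
      add_comm b]
    exact partitionFunction_le_mul fun x hx ↦ h x hx n
  calc expGrowthSup (partitionFunction T F φ V)
      ≤ expGrowthSup (w * partitionFunction T F ψ V) :=
        expGrowthSup_le_of_eventually_le ENNReal.ofReal_ne_top (Eventually.of_forall hZ)
    _ ≤ a + expGrowthSup (partitionFunction T F ψ V) := by
        rw [← hw]
        exact expGrowthSup_mul_le (Or.inl (hw ▸ EReal.coe_ne_bot a))
          (Or.inl (hw ▸ EReal.coe_ne_top a))
    _ ≤ topologicalPressure T F ψ + a := by
        rw [add_comm]
        gcongr
        exact expGrowthSup_partitionFunction_le hV ψ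

/-- Expansivity at the scale `V` makes `(W, n)`-nets into `(V, n + m)`-nets, so that no scale
carries more than twice the entropy at the scale `V`. -/
theorem coverEntropy_lt_top_of_expansive (hF : IsCompact F) (hT : Set.MapsTo T F F)
    (hV : V ∈ 𝓤 X) [V.IsSymm] (hexp : ∀ W ∈ 𝓤 X, ∃ m, ∀ x ∈ F, ∀ y ∈ F,
      (x, y) ∈ dynEntourage T (V ○ V) m → (x, y) ∈ W) :
    coverEntropy T F < ⊤ := by
  have hfin : netEntropyEntourage T F V < ⊤ :=
    (netEntropyEntourage_le_coverEntropyEntourage T F).trans_lt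
      (coverEntropyEntourage_finite_of_isCompact_invariant hF hT hV)
  have hnet : ∀ W ∈ 𝓤 X, ∃ m, ∀ n, netMaxcard T F W n ≤ netMaxcard T F V (n + m) := by
    intro W hW
    obtain ⟨m, hm⟩ := hexp W hW
    refine ⟨m, fun n ↦ iSup₂_le fun E hE ↦ IsDynNetIn.card_le_netMaxcard ⟨hE.1, ?_⟩⟩
    refine fun x hx y hy hxy ↦ Set.disjoint_iff_inter_eq_empty.2 (Set.not_nonempty_iff_eq_empty.1
      fun hne ↦ Set.disjoint_left.1 (hE.2 hy hx hxy.symm) (?_ : x ∈ _) ?_)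
    · have hclose := mem_dynEntourage.1 (mem_ball_dynEntourage_comp T (n + m) x y hne)
      refine mem_ball_dynEntourage.2 fun k hk ↦
        hm _ (hT.iterate k (hE.1 hy)) _ (hT.iterate k (hE.1 hx)) (mem_dynEntourage.2 fun j hj ↦ ?_)
      simpa only [← Function.iterate_add_apply] using hclose (j + k) (by omega)
    · exact mem_ball_dynEntourage.2 fun k _ ↦ UniformSpace.mem_ball_self _ hW
  have hle : coverEntropy T F ≤ (2 : ℕ) * netEntropyEntourage T F V := by
    rw [coverEntropy_eq_iSup_netEntropyEntourage]
    refine iSup₂_le fun W hW ↦ ?_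
    obtain ⟨m, hm⟩ := hnet W hW
    have hmono : Monotone fun n ↦ (netMaxcard T F V n : ENNReal) :=
      ENat.toENNReal_mono.comp (netMaxcard_monotone_time T F V)
    rw [netEntropyEntourage, netEntropyEntourage, ← hmono.expGrowthSup_comp_mul two_ne_zero]
    refine expGrowthSup_eventually_monotone ?_
    filter_upwards [eventually_ge_atTop m] with n hn
    exact ENat.toENNReal_mono ((hm n).trans (netMaxcard_monotone_time T F V (by omega)))
  exact hle.trans_lt (lt_top_iff_ne_top.2 ((EReal.mul_ne_top _ _).2
    ⟨Or.inl (EReal.natCast_ne_bot 2), Or.inl (mod_cast Nat.zero_le 2),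
      Or.inl (EReal.natCast_ne_top 2), Or.inr hfin.ne⟩))

end Pressure

theorem exists_eq_zero_of_decrease_mem_Icc {f : ℝ → ℝ} {α β : ℝ} (hα : 0 < α) (h0 : 0 < f 0)
    (hle : ∀ s t, 0 ≤ s → s ≤ t → f t ≤ f s - α * (t - s))
    (hge : ∀ s t, 0 ≤ s → s ≤ t → f s ≤ f t + β * (t - s)) :
    ∃ t, 0 ≤ t ∧ f t = 0 := by
  have hβ : 0 ≤ β := by linarith [hle 0 1 le_rfl zero_le_one, hge 0 1 le_rfl zero_le_one]
  have hcont : ContinuousOn f (Set.Ici 0) := by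
    refine (LipschitzOnWith.of_le_add_mul' β fun s hs t ht ↦ ?_).continuousOn
    rcases le_total s t with hst | hst
    · rw [dist_comm, Real.dist_eq, abs_of_nonneg (sub_nonneg.2 hst)]
      exact hge s t hs hst
    · have h1 := mul_nonneg hα.le (sub_nonneg.2 hst)
      have h2 : 0 ≤ β * dist s t := mul_nonneg hβ dist_nonneg
      linarith [hle t s ht hst]
  have hb : 0 ≤ f 0 / α := (div_pos h0 hα).le
  have hfb : f (f 0 / α) ≤ 0 := by
    have := hle 0 (f 0 / α) le_rfl hb
    rwa [sub_zero, mul_div_cancel₀ _ hα.ne', sub_self] at this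
  obtain ⟨t, ht, hft⟩ := intermediate_value_Icc' hb (hcont.mono Set.Icc_subset_Ici_self)
    ⟨hfb, h0.le⟩
  exact ⟨t, ht.1, hft⟩

theorem exists_eq_zero_and_strictAntiOn {f : ℝ → EReal} {α β : ℝ} (hα : 0 < α) (h0 : 0 < f 0)
    (htop : f 0 < ⊤) (hle : ∀ s t, 0 ≤ s → s ≤ t → f t ≤ f s + (-(α * (t - s)) : ℝ))
    (hge : ∀ s t, 0 ≤ s → s ≤ t → f s ≤ f t + (β * (t - s) : ℝ)) :
    ∃ t : ℝ, 0 < t ∧ f t = 0 ∧ StrictAntiOn f (Set.Ici 0) := by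
  have hreal (s : ℝ) (hs : 0 ≤ s) : f s = ((f s).toReal : EReal) := by
    refine (EReal.coe_toReal (fun h ↦ ?_) fun h ↦ ?_).symm
    · have := hle 0 s le_rfl hs
      rw [h, top_le_iff] at this
      exact (EReal.add_lt_top htop.ne (EReal.coe_ne_top _)).ne this
    · have := hge 0 s le_rfl hs
      rw [h, EReal.bot_add] at this
      exact (h0.trans_le this).not_ge bot_le
  set g : ℝ → ℝ := fun s ↦ (f s).toReal
  have hgle (s t : ℝ) (hs : 0 ≤ s) (hst : s ≤ t) : g t ≤ g s - α * (t - s) := by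
    have := hle s t hs hst
    rw [hreal s hs, hreal t (hs.trans hst)] at this
    exact_mod_cast this
  have hgge (s t : ℝ) (hs : 0 ≤ s) (hst : s ≤ t) : g s ≤ g t + β * (t - s) := by
    have := hge s t hs hst
    rw [hreal s hs, hreal t (hs.trans hst)] at this
    exact_mod_cast this
  have hg0 : 0 < g 0 := by
    rw [hreal 0 le_rfl] at h0
    exact_mod_cast h0
  obtain ⟨t, ht, hgt⟩ := exists_eq_zero_of_decrease_mem_Icc hα hg0 hgle hgge
  have ht0 : t ≠ 0 := by
    rintro rfl
    exact hg0.ne' hgt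
  refine ⟨t, ht.lt_of_ne' ht0, by rw [hreal t ht]; exact_mod_cast hgt, fun s hs u hu hsu ↦ ?_⟩
  rw [hreal s hs, hreal u hu, EReal.coe_lt_coe_iff]
  linarith [hgle s u hs hsu.le, mul_pos hα (sub_pos.2 hsu)]

theorem exists_dist_lt_imp_mem {α : Type*} [PseudoMetricSpace α]
    {V : SetRel (ℕ → α) (ℕ → α)} (hV : V ∈ 𝓤 (ℕ → α)) :
    ∃ (k : ℕ) (ρ : ℝ), 0 < ρ ∧ ∀ x y : ℕ → α, (∀ i < k, dist (x i) (y i) < ρ) → (x, y) ∈ V := by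
  have hbasis := Filter.HasBasis.iInf' fun i : ℕ ↦
    (uniformity_basis_dist (α := α)).comap fun a : (ℕ → α) × (ℕ → α) ↦ (a.1 i, a.2 i)
  rw [Pi.uniformity, hbasis.mem_iff] at hV
  obtain ⟨⟨I, r⟩, ⟨hI, hr⟩, hIV⟩ := hV
  obtain ⟨k, hk⟩ := hI.bddAbove
  have hsmall : ∀ᶠ ρ : ℝ in 𝓝[>] 0, ∀ i ∈ I, ρ < r i :=
    hI.eventually_all.2 fun i hi ↦ mem_of_superset (Ioo_mem_nhdsGT (hr i hi)) fun _ hρ ↦ hρ.2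
  obtain ⟨ρ, hρr, hρ⟩ := (hsmall.and self_mem_nhdsWithin).exists
  refine ⟨k + 1, ρ, hρ, fun x y hxy ↦ hIV (Set.mem_iInter₂.2 fun i hi ↦ ?_)⟩
  exact (hxy i (Nat.lt_succ_of_le (hk hi))).trans (hρr i hi)

theorem exists_norm_pow_sub_one_bounds {n : ℕ} (hn : n ≠ 0) {η : ℝ} (hη : 0 < η) :
    ∃ θ > 0, ∀ t : ℂ, dist t 1 < θ →
      n * ‖t - 1‖ ≤ Real.exp η * ‖t ^ n - 1‖ ∧ ‖t ^ n - 1‖ ≤ Real.exp η * (n * ‖t - 1‖) := by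
  set κ := 1 - Real.exp (-η)
  have hκ : 0 < κ := sub_pos.2 (Real.exp_lt_one_iff.2 (neg_neg_of_pos hη))
  have hn0 : (0 : ℝ) < n := Nat.cast_pos.2 (Nat.pos_of_ne_zero hn)
  obtain ⟨θ, hθ, h⟩ := Metric.eventually_nhds_iff.1
    ((hasDerivAt_pow n (1 : ℂ)).isLittleO.def (mul_pos hκ hn0))
  refine ⟨θ, hθ, fun t ht ↦ ?_⟩
  have hlin : ‖(t ^ n - 1) - n * (t - 1)‖ ≤ κ * (n * ‖t - 1‖) := by
    simpa [mul_comm, mul_assoc, mul_left_comm] using h ht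
  have hnorm : ‖(n : ℂ) * (t - 1)‖ = n * ‖t - 1‖ := by rw [norm_mul, Complex.norm_natCast]
  set a := n * ‖t - 1‖
  have : 0 ≤ a := by positivity
  constructor
  · have : Real.exp (-η) * a ≤ ‖t ^ n - 1‖ := by
      linarith [norm_sub_norm_le (n * (t - 1)) (t ^ n - 1), norm_sub_rev (t ^ n - 1) (n * (t - 1))]
    rwa [Real.exp_neg, inv_mul_le_iff₀ (Real.exp_pos η)] at this
  · have hexp : 1 + κ ≤ Real.exp η := by
      linarith [Real.add_one_le_exp η, Real.add_one_le_exp (-η)]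
    calc ‖t ^ n - 1‖ ≤ (1 + κ) * a := by
          linarith [norm_sub_norm_le (t ^ n - 1) (n * (t - 1))]
      _ ≤ Real.exp η * a := by gcongr

theorem exists_norm_pow_sub_pow_bounds {n : ℕ} (hn : n ≠ 0) {η : ℝ} (hη : 0 < η) :
    ∃ θ > 0, ∀ x y : ℂ, dist x y < θ * ‖x‖ →
      n * ‖x‖ ^ (n - 1) * dist x y ≤ Real.exp η * ‖x ^ n - y ^ n‖ ∧
        ‖x ^ n - y ^ n‖ ≤ Real.exp η * (n * ‖x‖ ^ (n - 1) * dist x y) := by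
  obtain ⟨θ, hθ, h⟩ := exists_norm_pow_sub_one_bounds hn hη
  refine ⟨θ, hθ, fun x y hxy ↦ ?_⟩
  have hx : x ≠ 0 := by
    rintro rfl
    rw [norm_zero, mul_zero] at hxy
    exact dist_nonneg.not_gt hxy
  have hdist : ‖x‖ * ‖y / x - 1‖ = dist x y := by
    rw [← norm_mul, mul_sub, mul_div_cancel₀ _ hx, mul_one, dist_comm, dist_eq_norm]
  have hpow : ‖x‖ ^ n * ‖(y / x) ^ n - 1‖ = ‖x ^ n - y ^ n‖ := by
    rw [← norm_pow, ← norm_mul, mul_sub, ← mul_pow, mul_div_cancel₀ _ hx, mul_one, norm_sub_rev]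
  have hlin : n * ‖x‖ ^ (n - 1) * dist x y = ‖x‖ ^ n * (n * ‖y / x - 1‖) := by
    rw [← hdist, ← pow_sub_one_mul hn ‖x‖]
    ring
  have hyx : dist (y / x) 1 < θ := by
    rwa [← hdist, mul_comm θ, mul_lt_mul_iff_right₀ (norm_pos_iff.2 hx), ← dist_eq_norm] at hxy
  obtain ⟨h1, h2⟩ := h _ hyx
  rw [hlin, ← hpow, mul_left_comm (Real.exp η), mul_left_comm (Real.exp η)]
  exact ⟨by gcongr, by gcongr⟩

theorem exists_eventually_dist_le_of_pow_eq {m n : ℕ} (hm : m ≠ 0) (hn : n ≠ 0) {x u : ℂ}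
    (hx : x ≠ 0) (h : u ^ n = x ^ m) :
    ∃ L : ℝ, ∀ᶠ v : ℂ × ℂ in 𝓝 (x, u), v.2 ^ n = v.1 ^ m → dist v.2 u ≤ L * dist v.1 x := by
  have hu : u ≠ 0 := by
    rintro rfl
    exact pow_ne_zero m hx (h.symm.trans (zero_pow hn))
  obtain ⟨θn, hθn, hroot⟩ := exists_norm_pow_sub_pow_bounds hn one_pos
  obtain ⟨θm, hθm, hpow⟩ := exists_norm_pow_sub_pow_bounds hm one_pos
  have hnear₁ : ∀ᶠ v : ℂ × ℂ in 𝓝 (x, u), dist x v.1 < θm * ‖x‖ :=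
    ContinuousAt.eventually_lt (by fun_prop) continuousAt_const (by rw [dist_self]; positivity)
  have hnear₂ : ∀ᶠ v : ℂ × ℂ in 𝓝 (x, u), dist u v.2 < θn * ‖u‖ :=
    ContinuousAt.eventually_lt (by fun_prop) continuousAt_const (by rw [dist_self]; positivity)
  set A : ℝ := n * ‖u‖ ^ (n - 1)
  have hA : 0 < A := by positivity
  refine ⟨Real.exp 1 * (Real.exp 1 * (m * ‖x‖ ^ (m - 1))) / A, ?_⟩
  filter_upwards [hnear₁, hnear₂] with v hv₁ hv₂ hv
  rw [dist_comm v.2, dist_comm v.1, div_mul_eq_mul_div, le_div_iff₀' hA]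
  calc A * dist u v.2 ≤ Real.exp 1 * ‖u ^ n - v.2 ^ n‖ := (hroot _ _ hv₂).1
    _ = Real.exp 1 * ‖x ^ m - v.1 ^ m‖ := by rw [h, hv]
    _ ≤ Real.exp 1 * (Real.exp 1 * (m * ‖x‖ ^ (m - 1) * dist x v.1)) := by
      gcongr
      exact (hpow _ _ hv₁).2
    _ = _ := by ring

namespace Correspondence

variable {p q : ℕ} {c : ℂ}

/-! ### Orbits and preimages -/

/-- The correspondence `𝐟_c` as a relation, which gives access to preimages of sets. -/
def graph (p q : ℕ) (c : ℂ) : SetRel ℂ ℂ := {z | IsImage p q c z.1 z.2}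

theorem isClosed_graph (p q : ℕ) (c : ℂ) : IsClosed (graph p q c : Set (ℂ × ℂ)) :=
  isClosed_eq (by fun_prop) (by fun_prop)

theorem isClosed_preimage_graph {S : Set ℂ} (hS : IsCompact S) :
    IsClosed ((graph p q c).preimage S) :=
  isClosed_setOf_exists_mem_of_isCompact hS (isClosed_graph p q c)

theorem exists_isImage_left [NeZero p] (q : ℕ) (c w : ℂ) : ∃ z, IsImage p q c z w := by
  obtain ⟨z, hz⟩ := IsAlgClosed.exists_pow_nat_eq ((w - c) ^ q) (NeZero.pos p)
  exact ⟨z, hz.symm⟩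

theorem cod_graph [NeZero p] (q : ℕ) (c : ℂ) : (graph p q c).cod = Set.univ :=
  Set.eq_univ_of_forall (exists_isImage_left q c)

theorem preimage_graph_closure_subset [NeZero p] (S : Set ℂ) :
    (graph p q c).preimage (closure S) ⊆ closure ((graph p q c).preimage S) := by
  rintro z ⟨w, hw, hzw⟩
  rw [Metric.mem_closure_iff]
  intro δ hδ
  have hopen : IsOpen {w' : ℂ | ‖z ^ p - (w' - c) ^ q‖ < δ ^ p} :=
    isOpen_lt (by fun_prop) continuous_const
  have hmem : ‖z ^ p - (w - c) ^ q‖ < δ ^ p := by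
    rw [show (w - c) ^ q = z ^ p from hzw, sub_self, norm_zero]
    positivity
  obtain ⟨w', hw', hw'S⟩ := mem_closure_iff.1 hw _ hopen hmem
  obtain ⟨u, hu, hzu⟩ := exists_pow_eq_norm_sub_pow_le (NeZero.ne p) ((w' - c) ^ q) z
  refine ⟨u, ⟨w', hw'S, hu.symm⟩, ?_⟩
  rw [dist_eq_norm]
  exact lt_of_pow_lt_pow_left₀ p hδ.le (hzu.trans_lt hw')

/-- A finite orbit `x 0 ↦ ⋯ ↦ x n`; the later terms of the sequence `x` are irrelevant. -/
def IsFiniteOrbit (p q : ℕ) (c : ℂ) (n : ℕ) (x : ℕ → ℂ) : Prop :=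
  ∀ i < n, IsImage p q c (x i) (x (i + 1))

/-- The derivative at `x 0` of the composition of the branches along the orbit
`x 0 ↦ ⋯ ↦ x n`. -/
noncomputable def multiplier (p q : ℕ) (c : ℂ) (n : ℕ) (x : ℕ → ℂ) : ℂ :=
  ∏ i ∈ Finset.range n, branchDeriv p q c (x i) (x (i + 1))

/-- The sequence `u, x 0, x 1, …`, which prolongs an orbit of `x 0` backwards. -/
def cons (u : ℂ) (x : ℕ → ℂ) : ℕ → ℂ
  | 0 => u
  | i + 1 => x i

theorem IsOrbit.isFiniteOrbit {x : ℕ → ℂ} (hx : IsOrbit p q c x) (n : ℕ) :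
    IsFiniteOrbit p q c n x := fun i _ ↦ hx i

theorem IsOrbit.cons {u : ℂ} {x : ℕ → ℂ} (hx : IsOrbit p q c x) (hu : IsImage p q c u (x 0)) :
    IsOrbit p q c (cons u x)
  | 0 => hu
  | i + 1 => hx i

namespace IsFiniteOrbit

variable {n : ℕ} {x : ℕ → ℂ}

theorem mono (hx : IsFiniteOrbit p q c n x) {m : ℕ} (hmn : m ≤ n) : IsFiniteOrbit p q c m x :=
  fun i hi ↦ hx i (hi.trans_le hmn)

theorem shift (hx : IsFiniteOrbit p q c (n + 1) x) : IsFiniteOrbit p q c n (shift x) :=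
  fun i hi ↦ hx (i + 1) (Nat.succ_lt_succ hi)

theorem cons {u : ℂ} (hx : IsFiniteOrbit p q c n x) (hu : IsImage p q c u (x 0)) :
    IsFiniteOrbit p q c (n + 1) (cons u x)
  | 0, _ => hu
  | i + 1, hi => hx i (Nat.lt_of_succ_lt_succ hi)

theorem mem_of_preimage_subset {S : Set ℂ} (hS : (graph p q c).preimage S ⊆ S)
    (hx : IsFiniteOrbit p q c n x) (hn : x n ∈ S) : ∀ i ≤ n, x i ∈ S := by
  induction n with
  | zero =>
    intro i hi
    rwa [Nat.le_zero.1 hi]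
  | succ n ih =>
    intro i hi
    rcases hi.lt_or_eq with hlt | rfl
    · exact ih (hx.mono n.le_succ) (hS ⟨_, hn, hx n n.lt_succ_self⟩) i (Nat.le_of_lt_succ hlt)
    · exact hn

theorem isOrbit_mod (hx : IsFiniteOrbit p q c n x) (h0 : 0 < n) (hn : x n = x 0) :
    IsOrbit p q c fun i ↦ x (i % n) := fun i ↦ by
  beta_reduce
  rw [apply_add_one_mod h0 hn]
  exact hx _ (Nat.mod_lt i h0)

end IsFiniteOrbit

theorem mem_iterate_preimage_graph {S : Set ℂ} {n : ℕ} {z : ℂ} :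
    z ∈ (graph p q c).preimage^[n] S ↔ ∃ x, IsFiniteOrbit p q c n x ∧ x 0 = z ∧ x n ∈ S := by
  induction n generalizing z with
  | zero =>
    refine ⟨fun hz ↦ ⟨fun _ ↦ z, fun i hi ↦ absurd hi i.not_lt_zero, rfl, hz⟩, ?_⟩
    rintro ⟨x, -, rfl, hx⟩
    exact hx
  | succ n ih =>
    rw [Function.iterate_succ_apply']
    constructor
    · rintro ⟨w, hw, hzw⟩
      obtain ⟨x, hx, rfl, hxS⟩ := ih.1 hw
      exact ⟨cons z x, hx.cons hzw, rfl, hxS⟩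
    · rintro ⟨x, hx, rfl, hxS⟩
      exact ⟨x 1, ih.2 ⟨shift x, hx.shift, rfl, hxS⟩, hx 0 n.succ_pos⟩

theorem multiplier_succ (n : ℕ) (x : ℕ → ℂ) :
    multiplier p q c (n + 1) x = multiplier p q c n (shift x) * branchDeriv p q c (x 0) (x 1) :=
  Finset.prod_range_succ' _ _

theorem multiplier_mod {n : ℕ} {x : ℕ → ℂ} (h0 : 0 < n) (hn : x n = x 0) (k : ℕ) :
    multiplier p q c (k * n) (fun i ↦ x (i % n)) = multiplier p q c n x ^ k := by
  have hper : Function.Periodic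
      (fun i ↦ branchDeriv p q c (x (i % n)) (x ((i + 1) % n))) n := fun i ↦ by
    simp only [Nat.add_mod_right, Nat.add_right_comm i n 1]
  unfold multiplier
  rw [prod_range_mul_of_periodic hper]
  congr 1
  refine Finset.prod_congr rfl fun i hi ↦ ?_
  rw [apply_add_one_mod h0 hn, Nat.mod_eq_of_lt (Finset.mem_range.1 hi)]

/-! ### Inverse branches -/

theorem branchDeriv_mul_deriv [NeZero p] [NeZero q] {φ ψ : ℂ → ℂ} {x : ℂ}
    (hφ : DifferentiableAt ℂ φ x) (hψ : DifferentiableAt ℂ ψ x) (hx : φ x ≠ c)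
    (h : ∀ᶠ ζ in 𝓝 x, IsImage p q c (ψ ζ) (φ ζ)) :
    branchDeriv p q c (ψ x) (φ x) * deriv ψ x = deriv φ x := by
  have hφ0 : φ x - c ≠ 0 := sub_ne_zero.2 hx
  have hψ0 : ψ x ≠ 0 := fun h0 ↦ pow_ne_zero q hφ0 <| by
    rw [show (φ x - c) ^ q = ψ x ^ p from h.self_of_nhds, h0, zero_pow (NeZero.ne p)]
  have hlog : logDeriv (fun ζ ↦ (φ ζ - c) ^ q) x = logDeriv (fun ζ ↦ ψ ζ ^ p) x := by
    have heq : (fun ζ ↦ (φ ζ - c) ^ q) =ᶠ[𝓝 x] fun ζ ↦ ψ ζ ^ p := h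
    rw [logDeriv_apply, logDeriv_apply, heq.deriv_eq,
      show (φ x - c) ^ q = ψ x ^ p from h.self_of_nhds]
  rw [logDeriv_fun_pow (hφ.sub_const c), logDeriv_fun_pow hψ, logDeriv_apply, logDeriv_apply,
    deriv_sub_const] at hlog
  have hq : (q : ℂ) ≠ 0 := NeZero.ne _
  rw [branchDeriv]
  field_simp at hlog ⊢
  linear_combination -hlog

theorem exists_differentiableOn_lift [NeZero p] [NeZero q] {φ : ℂ → ℂ} {x z : ℂ} {r : ℝ}
    (hr : 0 < r) (hφ : DifferentiableOn ℂ φ (ball x r)) (hc : ∀ ζ ∈ ball x r, φ ζ ≠ c)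
    (hz : IsImage p q c z (φ x)) :
    ∃ ψ : ℂ → ℂ, DifferentiableOn ℂ ψ (ball x r) ∧ ψ x = z ∧
      ∀ ζ ∈ ball x r, IsImage p q c (ψ ζ) (φ ζ) ∧
        branchDeriv p q c (ψ ζ) (φ ζ) * deriv ψ ζ = deriv φ ζ := by
  obtain ⟨g, hg, hg0, hexp⟩ := exists_eqOn_ball_mul_exp hr (hφ.sub_const c)
    fun ζ hζ ↦ sub_ne_zero.2 (hc ζ hζ)
  set ψ : ℂ → ℂ := fun ζ ↦ z * Complex.exp (q / p * g ζ) with hψ_def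
  have hψ : DifferentiableOn ℂ ψ (ball x r) := (hg.const_mul _).cexp.const_mul z
  have him : ∀ ζ ∈ ball x r, IsImage p q c (ψ ζ) (φ ζ) := by
    intro ζ hζ
    have hp : (p : ℂ) ≠ 0 := NeZero.ne _
    have hφζ : φ ζ - c = (φ x - c) * Complex.exp (g ζ) := hexp hζ
    have hzp : (φ x - c) ^ q = z ^ p := hz
    calc (φ ζ - c) ^ q = z ^ p * Complex.exp (q * g ζ) := by
          rw [hφζ, mul_pow, ← Complex.exp_nat_mul, hzp]
      _ = z ^ p * Complex.exp (p * (q / p * g ζ)) := by rw [← mul_assoc, mul_div_cancel₀ _ hp]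
      _ = ψ ζ ^ p := by rw [hψ_def, mul_pow, ← Complex.exp_nat_mul]
  refine ⟨ψ, hψ, by simp [ψ, hg0], fun ζ hζ ↦ ⟨him ζ hζ, ?_⟩⟩
  have hnhds := isOpen_ball.mem_nhds hζ
  exact branchDeriv_mul_deriv (hφ.differentiableAt hnhds) (hψ.differentiableAt hnhds) (hc ζ hζ)
    (eventually_of_mem hnhds him)

/-! ### Expansion on trapping domains -/

/-- A trapping domain of `𝐟_c`: a bounded open set, of diameter at most `R`, that contains the
repelling cycles, omits the critical value `c`, and contains the `ε`-neighbourhood of its own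
preimage. On such a domain the inverse branches contract, so the correspondence is hyperbolic. -/
structure IsTrappingDomain (p q : ℕ) (c : ℂ) (U : Set ℂ) (ε R : ℝ) : Prop where
  isOpen : IsOpen U
  nonempty : U.Nonempty
  notMem : c ∉ U
  margin_pos : 0 < ε
  bound_pos : 0 < R
  dist_le : ∀ z ∈ U, ∀ w ∈ U, dist z w ≤ R
  ball_subset : ∀ z w, IsImage p q c z w → w ∈ U → ball z ε ⊆ U
  cycle_subset : ∀ n z, IsRepellingCycle p q c n z → ∀ i < n, z i ∈ U

namespace IsTrappingDomain

variable {U : Set ℂ} {ε R : ℝ} {n : ℕ} {x : ℕ → ℂ}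

theorem isBounded (hU : IsTrappingDomain p q c U ε R) : Bornology.IsBounded U :=
  Metric.isBounded_iff.2 ⟨R, fun z hz w hw ↦ hU.dist_le z hz w hw⟩

theorem preimage_subset (hU : IsTrappingDomain p q c U ε R) : (graph p q c).preimage U ⊆ U := by
  rintro z ⟨w, hw, h⟩
  exact hU.ball_subset z w h hw (mem_ball_self hU.margin_pos)

theorem ne_zero_of_isImage [NeZero p] [NeZero q] (hU : IsTrappingDomain p q c U ε R) {z w : ℂ}
    (h : IsImage p q c z w) (hw : w ∈ U) : z ≠ 0 := by
  rintro rfl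
  rw [IsImage, zero_pow (NeZero.ne p), pow_eq_zero_iff (NeZero.ne q), sub_eq_zero] at h
  exact hU.notMem (h ▸ hw)

theorem one_lt (hU : IsTrappingDomain p q c U ε R) : 1 < 1 + ε / R :=
  lt_add_of_pos_right 1 (div_pos hU.margin_pos hU.bound_pos)

theorem norm_deriv_le (hU : IsTrappingDomain p q c U ε R) {ψ : ℂ → ℂ}
    (hψ : DifferentiableOn ℂ ψ (ball 0 1)) (hψU : Set.MapsTo ψ (ball 0 1) U) :
    ‖deriv ψ 0‖ ≤ R := by
  simpa using Complex.norm_deriv_le_div_of_mapsTo_ball hψ (fun ζ hζ ↦ mem_closedBall.2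
    (hU.dist_le _ (hψU hζ) _ (hψU (mem_ball_self one_pos)))) one_pos

/-- The preimage of `U` keeps the distance `ε` from the boundary of `U`, which leaves room for
adding the linear map `ε / R * ψ' 0` to a disc `ψ` in the preimage. -/
theorem exists_enlarged_disc (hU : IsTrappingDomain p q c U ε R) {ψ : ℂ → ℂ}
    (hψ : DifferentiableOn ℂ ψ (ball 0 1))
    (hψU : Set.MapsTo ψ (ball 0 1) ((graph p q c).preimage U)) :
    ∃ χ : ℂ → ℂ, DifferentiableOn ℂ χ (ball 0 1) ∧ Set.MapsTo χ (ball 0 1) U ∧ χ 0 = ψ 0 ∧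
      deriv χ 0 = (1 + ε / R : ℝ) * deriv ψ 0 := by
  have hR := hU.bound_pos
  have hεR : 0 < ε / R := div_pos hU.margin_pos hR
  refine ⟨fun ζ ↦ ψ ζ + (ε / R : ℝ) * (deriv ψ 0 * ζ), by fun_prop, fun ζ hζ ↦ ?_, by simp, ?_⟩
  · obtain ⟨w, hw, him⟩ := hψU hζ
    refine hU.ball_subset _ _ him hw ?_
    rw [mem_ball, dist_add_ofReal_mul hεR.le, norm_mul]
    have hder := hU.norm_deriv_le hψ (hψU.mono_right hU.preimage_subset)
    calc ε / R * (‖deriv ψ 0‖ * ‖ζ‖) ≤ ε / R * (R * ‖ζ‖) := by gcongr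
      _ = ε * ‖ζ‖ := by field_simp
      _ < ε := mul_lt_of_lt_one_right hU.margin_pos (mem_ball_zero_iff.1 hζ)
  · have hψ0 := (hψ.differentiableAt (ball_mem_nhds 0 one_pos)).hasDerivAt
    have hlin := ((hasDerivAt_id (0 : ℂ)).const_mul (deriv ψ 0)).const_mul ((ε / R : ℝ) : ℂ)
    refine (hψ0.add hlin).deriv.trans ?_
    push_cast
    ring

theorem exists_disc_of_isFiniteOrbit [NeZero p] [NeZero q] (hU : IsTrappingDomain p q c U ε R)
    {d : ℝ} (hd : 0 < d) (hx : IsFiniteOrbit p q c n x) (hb : ball (x n) d ⊆ U) :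
    ∃ ψ : ℂ → ℂ, DifferentiableOn ℂ ψ (ball 0 1) ∧ Set.MapsTo ψ (ball 0 1) U ∧ ψ 0 = x 0 ∧
      ‖multiplier p q c n x‖ * ‖deriv ψ 0‖ = d * (1 + ε / R) ^ n := by
  induction n generalizing x with
  | zero =>
    refine ⟨fun ζ ↦ x 0 + d * ζ, by fun_prop,
      (mapsTo_add_ofReal_mul_unitBall hd _).mono_right hb, by simp, ?_⟩
    simp [multiplier, abs_of_pos hd]
  | succ n ih =>
    obtain ⟨φ, hφ, hφU, hφ0, hder⟩ := ih hx.shift hb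
    have h0 : (0 : ℂ) ∈ ball (0 : ℂ) 1 := mem_ball_self one_pos
    obtain ⟨ψ, hψ, hψ0, him⟩ := exists_differentiableOn_lift one_pos hφ
      (fun ζ hζ (h : φ ζ = c) ↦ hU.notMem (h ▸ hφU hζ)) (z := x 0)
      (by rw [hφ0]; exact hx 0 n.succ_pos)
    obtain ⟨χ, hχ, hχU, hχ0, hχd⟩ := hU.exists_enlarged_disc hψ
      fun ζ hζ ↦ ⟨φ ζ, hφU hζ, (him ζ hζ).1⟩
    refine ⟨χ, hχ, hχU, hχ0.trans hψ0, ?_⟩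
    have hchain : branchDeriv p q c (x 0) (x 1) * deriv ψ 0 = deriv φ 0 := by
      have h := (him 0 h0).2
      rwa [hψ0, hφ0] at h
    rw [← hchain, norm_mul, ← mul_assoc] at hder
    rw [multiplier_succ, norm_mul, hχd, norm_mul, Complex.norm_of_nonneg (by linarith [hU.one_lt]),
      pow_succ]
    linear_combination (1 + ε / R) * hder

theorem le_norm_multiplier [NeZero p] [NeZero q] (hU : IsTrappingDomain p q c U ε R) {d : ℝ}
    (hd : 0 < d) (hx : IsFiniteOrbit p q c n x) (hb : ball (x n) d ⊆ U) :
    d / R * (1 + ε / R) ^ n ≤ ‖multiplier p q c n x‖ := by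
  obtain ⟨ψ, hψ, hψU, -, hder⟩ := hU.exists_disc_of_isFiniteOrbit hd hx hb
  rw [div_mul_eq_mul_div, div_le_iff₀ hU.bound_pos, ← hder]
  gcongr
  exact hU.norm_deriv_le hψ hψU

theorem exists_pullback [NeZero p] [NeZero q] (hU : IsTrappingDomain p q c U ε R) {φ : ℂ → ℂ}
    (hφ : DifferentiableOn ℂ φ (ball 0 1)) (hφU : Set.MapsTo φ (ball 0 1) U)
    (hx : IsFiniteOrbit p q c n x) (hφ0 : φ 0 = x n) :
    ∃ Ψ : ℕ → ℂ → ℂ, DifferentiableOn ℂ (Ψ 0) (ball 0 1) ∧ Set.MapsTo (Ψ 0) (ball 0 1) U ∧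
      Ψ 0 0 = x 0 ∧ Ψ n = φ ∧ ∀ ζ ∈ ball (0 : ℂ) 1, IsFiniteOrbit p q c n (Ψ · ζ) ∧
        multiplier p q c n (Ψ · ζ) * deriv (Ψ 0) ζ = deriv φ ζ := by
  induction n generalizing x with
  | zero =>
    exact ⟨fun _ ↦ φ, hφ, hφU, hφ0, rfl, fun ζ _ ↦ ⟨fun i hi ↦ absurd hi i.not_lt_zero, by
      simp [multiplier]⟩⟩
  | succ n ih =>
    obtain ⟨Φ, hΦ, hΦU, hΦ0, hΦn, horb⟩ := ih hx.shift hφ0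
    obtain ⟨ψ, hψ, hψ0, him⟩ := exists_differentiableOn_lift one_pos hΦ
      (fun ζ hζ (h : Φ 0 ζ = c) ↦ hU.notMem (h ▸ hΦU hζ)) (z := x 0)
      (by rw [hΦ0]; exact hx 0 n.succ_pos)
    have hψU : Set.MapsTo ψ (ball 0 1) U := fun ζ hζ ↦
      hU.preimage_subset ⟨_, hΦU hζ, (him ζ hζ).1⟩
    set Ψ : ℕ → ℂ → ℂ := fun i ζ ↦ cons (ψ ζ) (Φ · ζ) i
    refine ⟨Ψ, hψ, hψU, hψ0, hΦn, fun ζ hζ ↦ ?_⟩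
    obtain ⟨hΦorb, hΦder⟩ := horb ζ hζ
    refine ⟨hΦorb.cons (him ζ hζ).1, ?_⟩
    rw [multiplier_succ, mul_assoc]
    exact (congrArg _ (him ζ hζ).2).trans hΦder

theorem exists_contracting_pullback [NeZero p] [NeZero q] (hU : IsTrappingDomain p q c U ε R)
    {δ : ℝ} (hδ : 0 < δ) (hx : IsFiniteOrbit p q c n x) (hb : ball (x n) δ ⊆ U) :
    ∃ Ψ : ℕ → ℂ → ℂ, DifferentiableOn ℂ (Ψ 0) (ball 0 1) ∧ Set.MapsTo (Ψ 0) (ball 0 1) U ∧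
      Ψ 0 0 = x 0 ∧ (∀ ζ, Ψ n ζ = x n + δ * ζ) ∧
      (∀ ζ ∈ ball (0 : ℂ) 1, IsFiniteOrbit p q c n (Ψ · ζ)) ∧
      ∀ ζ ∈ closedBall (0 : ℂ) (1 / 2), ‖deriv (Ψ 0) ζ‖ ≤ 2 * R / (1 + ε / R) ^ n := by
  obtain ⟨Ψ, hΨ, hΨU, hΨ0, hΨn, horb⟩ := hU.exists_pullback (φ := fun ζ ↦ x n + δ * ζ)
    (by fun_prop) ((mapsTo_add_ofReal_mul_unitBall hδ _).mono_right hb) hx (by simp)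
  refine ⟨Ψ, hΨ, hΨU, hΨ0, congrFun hΨn, fun ζ hζ ↦ (horb ζ hζ).1, fun ζ hζ ↦ ?_⟩
  have hball : ball (Ψ n ζ) (δ / 2) ⊆ U := by
    refine (ball_subset_ball' ?_).trans hb
    rw [hΨn, dist_add_ofReal_mul hδ.le]
    nlinarith [mem_closedBall_zero_iff.1 hζ]
  obtain ⟨hζorb, hζder⟩ := horb ζ (closedBall_subset_ball (by norm_num) hζ)
  have hexp := hU.le_norm_multiplier (half_pos hδ) hζorb hball
  have hmul : ‖multiplier p q c n (Ψ · ζ)‖ * ‖deriv (Ψ 0) ζ‖ = δ := by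
    rw [← norm_mul, hζder]
    simp [abs_of_pos hδ]
  have hR := hU.bound_pos
  rw [le_div_iff₀ (pow_pos (zero_lt_one.trans hU.one_lt) n)]
  calc ‖deriv (Ψ 0) ζ‖ * (1 + ε / R) ^ n
      = 2 * R / δ * (δ / 2 / R * (1 + ε / R) ^ n * ‖deriv (Ψ 0) ζ‖) := by
        generalize (1 + ε / R) ^ n = Λ
        field_simp
    _ ≤ 2 * R / δ * δ := by
        gcongr
        exact (mul_le_mul_of_nonneg_right hexp (norm_nonneg _)).trans hmul.le
    _ = 2 * R := div_mul_cancel₀ _ hδ.ne'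

/-- Closing lemma: the inverse branch along a long orbit that almost returns has a fixed point. -/
theorem exists_closed_orbit [NeZero p] [NeZero q] (hU : IsTrappingDomain p q c U ε R) {δ : ℝ}
    (hδ : 0 < δ) : ∃ N : ℕ, ∀ n ≥ N, ∀ x : ℕ → ℂ, IsFiniteOrbit p q c n x → ball (x n) δ ⊆ U →
      dist (x 0) (x n) < δ / 4 →
      ∃ y : ℕ → ℂ, IsFiniteOrbit p q c n y ∧ y n = y 0 ∧ y 0 ∈ U ∧ dist (y 0) (x n) < δ := by
  obtain ⟨N, hN⟩ := pow_unbounded_of_one_lt (4 * R / δ) hU.one_lt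
  refine ⟨N, fun n hn x hx hb hret ↦ ?_⟩
  have hsmall : 2 * R / (1 + ε / R) ^ n ≤ δ / 2 := by
    have hΛN := hN.le.trans (pow_le_pow_right₀ hU.one_lt.le hn)
    rw [div_le_iff₀ hδ] at hΛN
    rw [div_le_iff₀ (pow_pos (zero_lt_one.trans hU.one_lt) n)]
    linarith
  obtain ⟨Ψ, hΨ, hΨU, hΨ0, hΨn, horb, hder⟩ := hU.exists_contracting_pullback hδ hx hb
  have hsub : closedBall (0 : ℂ) (1 / 2) ⊆ ball 0 1 := closedBall_subset_ball (by norm_num)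
  obtain ⟨ζ, hζ, hfix⟩ := exists_eq_add_mul_of_norm_deriv_le hδ
    (fun ζ hζ ↦ hΨ.differentiableAt (isOpen_ball.mem_nhds (hsub hζ)))
    (fun ζ hζ ↦ (hder ζ hζ).trans hsmall) (hΨ0 ▸ hret.le)
  refine ⟨(Ψ · ζ), horb ζ (hsub hζ), (hΨn ζ).trans hfix.symm, hΨU (hsub hζ), ?_⟩
  change dist (Ψ 0 ζ) (x n) < δ
  rw [hfix]
  exact mapsTo_add_ofReal_mul_unitBall hδ _ (hsub hζ)

theorem one_lt_norm_multiplier [NeZero p] [NeZero q] (hU : IsTrappingDomain p q c U ε R)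
    (h0 : 0 < n) (hx : IsFiniteOrbit p q c n x) (hn : x n = x 0) (hxU : x 0 ∈ U) :
    1 < ‖multiplier p q c n x‖ := by
  by_contra! hle
  obtain ⟨d, hd, hball⟩ := Metric.isOpen_iff.1 hU.isOpen _ hxU
  have hdR : 0 < d / R := div_pos hd hU.bound_pos
  obtain ⟨k, hk⟩ := pow_unbounded_of_one_lt (d / R)⁻¹ hU.one_lt
  have hexp := hU.le_norm_multiplier hd ((hx.isOrbit_mod h0 hn).isFiniteOrbit (k * n))
    (by simpa using hball)
  rw [multiplier_mod h0 hn, norm_pow] at hexp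
  refine (hexp.trans (pow_le_one₀ (norm_nonneg _) hle)).not_gt ?_
  calc 1 = d / R * (d / R)⁻¹ := (mul_inv_cancel₀ hdR.ne').symm
    _ < d / R * (1 + ε / R) ^ (k * n) := by
        gcongr
        exact hk.trans_le (pow_le_pow_right₀ hU.one_lt.le (Nat.le_mul_of_pos_right k h0))

/-! ### The Julia set -/

theorem mem_juliaSet_of_closed_orbit [NeZero p] [NeZero q] (hU : IsTrappingDomain p q c U ε R)
    (h0 : 0 < n) (hx : IsFiniteOrbit p q c n x) (hn : x n = x 0) (hxU : x 0 ∈ U) :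
    x 0 ∈ juliaSet p q c := by
  classical
  have hex : ∃ m, 0 < m ∧ x m = x 0 := ⟨n, h0, hn⟩
  obtain ⟨hm0, hm⟩ := Nat.find_spec hex
  have hxm := hx.mono (Nat.find_min' hex ⟨h0, hn⟩)
  have hmem := hxm.mem_of_preimage_subset hU.preimage_subset (hm.symm ▸ hxU)
  exact subset_closure ⟨_, x, ⟨hm0, hxm, hm, fun i hi him h ↦ Nat.find_min hex him ⟨hi, h⟩,
    fun i hi ↦ hU.ne_zero_of_isImage (hxm i hi) (hmem (i + 1) hi),
    hU.one_lt_norm_multiplier hm0 hxm hm hxU⟩, 0, hm0, rfl⟩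

theorem ball_subset_of_mem_closure (hU : IsTrappingDomain p q c U ε R) {z : ℂ}
    (hz : z ∈ closure ((graph p q c).preimage U)) : ball z ε ⊆ U := by
  intro y hy
  obtain ⟨z', ⟨w, hw, hzw⟩, hz'⟩ := Metric.mem_closure_iff.1 hz (ε - dist y z)
    (sub_pos.2 (mem_ball.1 hy))
  refine hU.ball_subset z' w hzw hw (mem_ball.2 ?_)
  linarith [dist_triangle y z z']

theorem closure_preimage_subset (hU : IsTrappingDomain p q c U ε R) :
    closure ((graph p q c).preimage U) ⊆ U :=
  fun _ hz ↦ hU.ball_subset_of_mem_closure hz (mem_ball_self hU.margin_pos)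

theorem isCompact_closure_preimage (hU : IsTrappingDomain p q c U ε R) :
    IsCompact (closure ((graph p q c).preimage U)) :=
  Metric.isCompact_of_isClosed_isBounded isClosed_closure
    (hU.isBounded.subset hU.closure_preimage_subset)

end IsTrappingDomain

theorem IsRepellingCycle.exists_isImage {n : ℕ} {z : ℕ → ℂ} (hz : IsRepellingCycle p q c n z)
    {i : ℕ} (hi : i < n) : ∃ j < n, IsImage p q c (z i) (z j) := by
  rcases (Nat.succ_le_of_lt hi).lt_or_eq with h | rfl
  · exact ⟨i + 1, h, hz.2.1 i hi⟩
  · exact ⟨0, hz.1, hz.2.2.1 ▸ hz.2.1 i hi⟩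

namespace IsTrappingDomain

variable {U : Set ℂ} {ε R : ℝ}

theorem juliaSet_subset (hU : IsTrappingDomain p q c U ε R) : juliaSet p q c ⊆ U := by
  refine (closure_mono ?_).trans hU.closure_preimage_subset
  rintro ζ ⟨n, z, hz, i, hi, rfl⟩
  obtain ⟨j, hj, hij⟩ := hz.exists_isImage hi
  exact ⟨z j, hU.cycle_subset n z hz j hj, hij⟩

theorem isCompact_juliaSet (hU : IsTrappingDomain p q c U ε R) : IsCompact (juliaSet p q c) :=
  Metric.isCompact_of_isClosed_isBounded isClosed_closure (hU.isBounded.subset hU.juliaSet_subset)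

theorem juliaSet_subset_preimage (hU : IsTrappingDomain p q c U ε R) :
    juliaSet p q c ⊆ (graph p q c).preimage (juliaSet p q c) := by
  refine closure_minimal ?_ (isClosed_preimage_graph hU.isCompact_juliaSet)
  rintro ζ ⟨n, z, hz, i, hi, rfl⟩
  obtain ⟨j, hj, hij⟩ := hz.exists_isImage hi
  exact ⟨z j, subset_closure ⟨n, z, hz, j, hj, rfl⟩, hij⟩

theorem exists_mem_orbitSpace (hU : IsTrappingDomain p q c U ε R) {z : ℂ}
    (hz : z ∈ juliaSet p q c) : ∃ x ∈ orbitSpace p q c, x 0 = z := by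
  choose! g hgJ hg using hU.juliaSet_subset_preimage
  have hmem (i : ℕ) : g^[i] z ∈ juliaSet p q c := (show Set.MapsTo g _ _ from hgJ).iterate i hz
  refine ⟨fun i ↦ g^[i] z, ⟨fun i ↦ ?_, hmem⟩, rfl⟩
  simp only [Function.iterate_succ_apply']
  exact hg (hmem i)

theorem isCompact_orbitSpace (hU : IsTrappingDomain p q c U ε R) :
    IsCompact (orbitSpace p q c) := by
  have hclosed : IsClosed {z : ℕ → ℂ | IsOrbit p q c z} := by
    simp only [IsOrbit, Set.ofPred_forall]
    exact isClosed_iInter fun i ↦ isClosed_eq (by fun_prop) (by fun_prop)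
  convert (isCompact_univ_pi fun _ ↦ hU.isCompact_juliaSet).inter_left hclosed using 1
  ext z
  simp [orbitSpace]

theorem exists_le_norm [NeZero p] [NeZero q] (hU : IsTrappingDomain p q c U ε R) :
    ∃ r > 0, ∀ z ∈ juliaSet p q c, r ≤ ‖z‖ := by
  have h0 : (0 : ℂ) ∉ juliaSet p q c := by
    intro h
    obtain ⟨w, hw, hzw⟩ := hU.juliaSet_subset_preimage h
    exact hU.ne_zero_of_isImage hzw (hU.juliaSet_subset hw) rfl
  obtain ⟨r, hr, hball⟩ := Metric.isOpen_iff.1 (isClosed_closure (s := _)).isOpen_compl 0 h0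
  refine ⟨r, hr, fun z hz ↦ not_lt.1 fun hlt ↦ ?_⟩
  exact hball (mem_ball_zero_iff.2 hlt) hz

theorem exists_backwardInvariant_subset_juliaSet [NeZero p] [NeZero q]
    (hU : IsTrappingDomain p q c U ε R) :
    ∃ Λ ⊆ juliaSet p q c, Λ.Nonempty ∧ (graph p q c).preimage Λ ⊆ Λ := by
  obtain ⟨w, hw⟩ := hU.nonempty
  obtain ⟨z, hzw⟩ := exists_isImage_left (p := p) q c w
  obtain ⟨Λ, hΛK, hΛne, hΛinv, hrec⟩ := exists_backwardInvariant_recurrent (cod_graph (p := p) q c)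
    preimage_graph_closure_subset hU.isCompact_closure_preimage isClosed_closure
    ⟨z, subset_closure ⟨w, hw, hzw⟩⟩
    ((SetRel.preimage_mono hU.closure_preimage_subset).trans subset_closure)
  refine ⟨Λ, fun z hz ↦ ?_, hΛne, hΛinv⟩
  have hJ : IsClosed (juliaSet p q c) := isClosed_closure
  rw [← hJ.closure_eq, Metric.mem_closure_iff]
  intro δ' hδ'
  have hδ : 0 < min δ' ε := lt_min hδ' hU.margin_pos
  obtain ⟨N, hN⟩ := hU.exists_closed_orbit hδ
  obtain ⟨y, hy, hdist⟩ := Metric.mem_closure_iff.1 (hrec z hz (N + 1)) (min δ' ε / 4)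
    (by positivity)
  simp only [Set.mem_iUnion] at hy
  obtain ⟨n, hn, hyn⟩ := hy
  obtain ⟨x, hx, rfl, rfl⟩ := mem_iterate_preimage_graph.1 hyn
  have hball : ball (x n) (min δ' ε) ⊆ U :=
    (ball_subset_ball (min_le_right _ _)).trans (hU.ball_subset_of_mem_closure (hΛK hz))
  obtain ⟨y, hy, hyn, hyU, hyd⟩ := hN n (by lia) x hx hball (by rwa [dist_comm])
  refine ⟨y 0, hU.mem_juliaSet_of_closed_orbit (by lia) hy hyn hyU, ?_⟩
  rw [dist_comm]
  exact hyd.trans_le (min_le_left _ _)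

end IsTrappingDomain

/-! ### Separated orbits -/

theorem exists_separated_image_cons {ι : Type*} [Fintype ι] {η : ℝ} (hη : 0 < η) {n : ℕ}
    {E : Finset (ℕ → ℂ)} {s : ι → ℂ → ℂ}
    (hE : (E : Set (ℕ → ℂ)).Pairwise fun x y ↦ ∃ i < n, η ≤ dist (x i) (y i))
    (hs : ∀ x ∈ E, Pairwise fun a b ↦ η ≤ dist (s a (x 0)) (s b (x 0))) :
    ∃ F : Finset (ℕ → ℂ), F.card = E.card * Fintype.card ι ∧
      (∀ y ∈ F, ∃ x ∈ E, ∃ a, y = cons (s a (x 0)) x) ∧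
      (F : Set (ℕ → ℂ)).Pairwise fun x y ↦ ∃ i < n + 1, η ≤ dist (x i) (y i) := by
  classical
  set b : (ℕ → ℂ) × ι → ℕ → ℂ := fun z ↦ cons (s z.2 (z.1 0)) z.1
  have hsep : ∀ z ∈ E ×ˢ Finset.univ, ∀ z' ∈ E ×ˢ Finset.univ, z ≠ z' →
      ∃ i < n + 1, η ≤ dist (b z i) (b z' i) := by
    rintro ⟨x, a⟩ hx ⟨x', a'⟩ hx' hne
    rw [Finset.mem_product] at hx hx'
    rcases eq_or_ne x x' with rfl | hxx'
    · exact ⟨0, n.succ_pos, hs x hx.1 fun h ↦ hne (Prod.ext rfl h)⟩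
    · obtain ⟨i, hi, hdist⟩ := hE hx.1 hx'.1 hxx'
      exact ⟨i + 1, Nat.succ_lt_succ hi, hdist⟩
  have hinj : Set.InjOn b (E ×ˢ Finset.univ : Finset ((ℕ → ℂ) × ι)) := by
    intro z hz z' hz' h
    by_contra hne
    obtain ⟨i, -, hi⟩ := hsep z hz z' hz' hne
    rw [h, dist_self] at hi
    exact hi.not_gt hη
  refine ⟨(E ×ˢ Finset.univ).image b, ?_, ?_, ?_⟩
  · rw [Finset.card_image_of_injOn hinj, Finset.card_product, Finset.card_univ]
  · intro y hy
    obtain ⟨⟨x, a⟩, hx, rfl⟩ := Finset.mem_image.1 hy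
    exact ⟨x, (Finset.mem_product.1 hx).1, a, rfl⟩
  · intro y hy y' hy' hne
    obtain ⟨z, hz, rfl⟩ := Finset.mem_image.1 hy
    obtain ⟨z', hz', rfl⟩ := Finset.mem_image.1 hy'
    exact hsep z hz z' hz' fun h ↦ hne (h ▸ rfl)

theorem exists_two_separated_preimages [NeZero p] (hp : 1 < p) (q : ℕ) (c : ℂ) :
    ∃ κ > 0, ∃ s : Bool → ℂ → ℂ, (∀ b w, IsImage p q c (s b w) w) ∧
      ∀ w, Pairwise fun a b ↦ κ * ‖s true w‖ ≤ dist (s a w) (s b w) := by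
  have hprim := Complex.isPrimitiveRoot_exp p (NeZero.ne p)
  set ζ := Complex.exp (2 * Real.pi * Complex.I / p)
  choose s hs using exists_isImage_left (p := p) q c
  have hdist (w : ℂ) : dist (s w) (ζ * s w) = ‖ζ - 1‖ * ‖s w‖ := by
    rw [dist_comm, dist_eq_norm, ← sub_one_mul, norm_mul]
  refine ⟨‖ζ - 1‖, norm_pos_iff.2 (sub_ne_zero.2 (hprim.ne_one hp)),
    fun b w ↦ if b then s w else ζ * s w, ?_, ?_⟩
  · rintro (_ | _) w
    · simpa [IsImage, mul_pow, hprim.pow_eq_one] using hs w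
    · simpa using hs w
  · rintro w (_ | _) (_ | _) hne
    · exact absurd rfl hne
    · simp [dist_comm (ζ * s w), hdist]
    · simp [hdist]
    · exact absurd rfl hne

namespace IsTrappingDomain

variable {U : Set ℂ} {ε R : ℝ}

theorem exists_separated [NeZero p] [NeZero q] (hU : IsTrappingDomain p q c U ε R) (hp : 1 < p) :
    ∃ η > 0, ∀ n : ℕ, ∃ E : Finset (ℕ → ℂ), E.card = 2 ^ n ∧
      (E : Set (ℕ → ℂ)) ⊆ orbitSpace p q c ∧
      (E : Set (ℕ → ℂ)).Pairwise fun x y ↦ ∃ i < n, η ≤ dist (x i) (y i) := by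
  obtain ⟨Λ, hΛJ, ⟨w, hw⟩, hΛ⟩ := hU.exists_backwardInvariant_subset_juliaSet
  obtain ⟨r, hr, hrJ⟩ := hU.exists_le_norm
  obtain ⟨κ, hκ, s, hs, hsep⟩ := exists_two_separated_preimages hp q c
  have hη : 0 < κ * r := mul_pos hκ hr
  have hcons : ∀ x ∈ orbitSpace p q c, x 0 ∈ Λ → ∀ b,
      cons (s b (x 0)) x ∈ orbitSpace p q c ∧ s b (x 0) ∈ Λ := by
    intro x hx hx0 b
    have hsΛ : s b (x 0) ∈ Λ := hΛ ⟨x 0, hx0, hs b _⟩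
    exact ⟨⟨hx.1.cons (hs b _), fun i ↦ i.casesOn (hΛJ hsΛ) hx.2⟩, hsΛ⟩
  have hηsep : ∀ w ∈ Λ, Pairwise fun a b ↦ κ * r ≤ dist (s a w) (s b w) := by
    intro w hw a b hab
    exact (mul_le_mul_of_nonneg_left (hrJ _ (hΛJ (hΛ ⟨w, hw, hs true w⟩))) hκ.le).trans (hsep w hab)
  suffices h : ∀ n, ∃ E : Finset (ℕ → ℂ), E.card = 2 ^ n ∧
      (∀ x ∈ E, x ∈ orbitSpace p q c ∧ x 0 ∈ Λ) ∧
      (E : Set (ℕ → ℂ)).Pairwise fun x y ↦ ∃ i < n, κ * r ≤ dist (x i) (y i) from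
    ⟨κ * r, hη, fun n ↦ (h n).imp fun E hE ↦ ⟨hE.1, fun x hx ↦ (hE.2.1 x hx).1, hE.2.2⟩⟩
  intro n
  induction n with
  | zero =>
    obtain ⟨x, hx, rfl⟩ := hU.exists_mem_orbitSpace (hΛJ hw)
    exact ⟨{x}, by simp, by simpa using ⟨hx, hw⟩, by simp⟩
  | succ n ih =>
    obtain ⟨E, hcard, hE, hEsep⟩ := ih
    obtain ⟨F, hFcard, hF, hFsep⟩ := exists_separated_image_cons hη hEsep
      fun x hx ↦ hηsep _ (hE x hx).2
    refine ⟨F, by rw [hFcard, hcard, Fintype.card_bool, pow_succ], fun y hy ↦ ?_, hFsep⟩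
    obtain ⟨x, hx, b, rfl⟩ := hF y hy
    exact hcons x (hE x hx).1 (hE x hx).2 b

end IsTrappingDomain

end Correspondence

namespace Correspondence

variable {p q : ℕ} {c : ℂ}

/-! ### Expansivity of the shift -/

theorem shift_iterate_apply (x : ℕ → ℂ) (k i : ℕ) : shift^[k] x i = x (i + k) := by
  induction k generalizing x with
  | zero => rfl
  | succ k ih =>
    rw [Function.iterate_succ_apply, ih]
    exact congrArg x (by ring)

theorem mapsTo_shift (p q : ℕ) (c : ℂ) :
    Set.MapsTo shift (orbitSpace p q c) (orbitSpace p q c) :=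
  fun _ hx ↦ ⟨fun i ↦ hx.1 (i + 1), fun i ↦ hx.2 (i + 1)⟩

theorem shift_iterate_mem_orbitSpace {x : ℕ → ℂ} (hx : x ∈ orbitSpace p q c) (k : ℕ) :
    shift^[k] x ∈ orbitSpace p q c :=
  (mapsTo_shift p q c).iterate k hx

/-- The entourage of the pairs of sequences whose first two terms are `δ`-close. Two terms are
used rather than one so that `n` iterates of the shift control all the endpoints `x 0, …, x n` of
the `n` branches along an orbit. -/
def initialEntourage (δ : ℝ) : SetRel (ℕ → ℂ) (ℕ → ℂ) :=
  {x | dist (x.1 0) (x.2 0) < δ ∧ dist (x.1 1) (x.2 1) < δ}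

theorem initialEntourage_mem_uniformity {δ : ℝ} (hδ : 0 < δ) :
    initialEntourage δ ∈ 𝓤 (ℕ → ℂ) :=
  inter_mem (Pi.uniformContinuous_proj (fun _ : ℕ ↦ ℂ) 0 (Metric.dist_mem_uniformity hδ))
    (Pi.uniformContinuous_proj (fun _ : ℕ ↦ ℂ) 1 (Metric.dist_mem_uniformity hδ))

instance isSymm_initialEntourage (δ : ℝ) : (initialEntourage δ).IsSymm where
  symm x y h := by rwa [initialEntourage, Set.mem_ofPred, dist_comm (y 0), dist_comm (y 1)]

theorem initialEntourage_comp_subset (δ δ' : ℝ) :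
    (initialEntourage δ).comp (initialEntourage δ') ⊆ initialEntourage (δ + δ') := by
  rintro ⟨x, y⟩ ⟨z, hxz, hzy⟩
  exact ⟨(dist_triangle _ (z 0) _).trans_lt (add_lt_add hxz.1 hzy.1),
    (dist_triangle _ (z 1) _).trans_lt (add_lt_add hxz.2 hzy.2)⟩

theorem mem_dynEntourage_initialEntourage {δ : ℝ} {n : ℕ} (hn : n ≠ 0) {x y : ℕ → ℂ} :
    (x, y) ∈ Dynamics.dynEntourage shift (initialEntourage δ) n ↔
      ∀ i ≤ n, dist (x i) (y i) < δ := by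
  simp only [Dynamics.mem_dynEntourage, initialEntourage, Set.mem_ofPred, shift_iterate_apply,
    zero_add]
  refine ⟨fun h i hi ↦ ?_, fun h k hk ↦ ⟨h k hk.le, h (1 + k) (by lia)⟩⟩
  rcases hi.lt_or_eq with hlt | rfl
  · exact (h i hlt).1
  · simpa only [Nat.one_add_sub_one, Nat.add_sub_cancel' (Nat.one_le_iff_ne_zero.2 hn)] using
      (h (i - 1) (by lia)).2

theorem dist_lt_of_mem_dynEntourage_comp {δ : ℝ} {n : ℕ} (hn : n ≠ 0) {x y : ℕ → ℂ}
    (h : (x, y) ∈ Dynamics.dynEntourage shift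
      ((initialEntourage (δ / 2)).comp (initialEntourage (δ / 2))) n) :
    ∀ i ≤ n, dist (x i) (y i) < δ := by
  have hsub := initialEntourage_comp_subset (δ / 2) (δ / 2)
  rw [add_halves] at hsub
  exact (mem_dynEntourage_initialEntourage hn).1 (Dynamics.dynEntourage_monotone shift n hsub h)

theorem isDynNetIn_of_separated {F E : Set (ℕ → ℂ)} {η : ℝ} {n : ℕ} (hE : E ⊆ F)
    (h : E.Pairwise fun x y ↦ ∃ i < n, η ≤ dist (x i) (y i)) :
    Dynamics.IsDynNetIn shift F (initialEntourage (η / 2)) n E := by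
  refine ⟨hE, fun x hx y hy hxy ↦ Set.disjoint_iff_inter_eq_empty.2
    (Set.not_nonempty_iff_eq_empty.1 fun hne ↦ ?_)⟩
  obtain ⟨i, hi, hdist⟩ := h hy hx hxy.symm
  exact hdist.not_gt (dist_lt_of_mem_dynEntourage_comp (Nat.ne_zero_of_lt hi)
    (Dynamics.mem_ball_dynEntourage_comp shift n x y hne) i hi.le)

/-- By the chain rule, `‖z ^ p - z' ^ p‖ = ‖(w - c) ^ q - (w' - c) ^ q‖` is comparable to both
`p * ‖z‖ ^ (p - 1) * dist z z'` and `q * ‖w - c‖ ^ (q - 1) * dist w w'`. -/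
theorem exists_dist_mul_norm_branchDeriv_le [NeZero p] [NeZero q] {η : ℝ} (hη : 0 < η) :
    ∃ θ > 0, ∀ c z w z' w' : ℂ, IsImage p q c z w → IsImage p q c z' w' →
      dist z z' < θ * ‖z‖ → dist w w' < θ * ‖w - c‖ →
      dist z z' * ‖branchDeriv p q c z w‖ ≤ Real.exp η * dist w w' := by
  obtain ⟨θp, hθp, hp⟩ := exists_norm_pow_sub_pow_bounds (NeZero.ne p) (half_pos hη)
  obtain ⟨θq, hθq, hq⟩ := exists_norm_pow_sub_pow_bounds (NeZero.ne q) (half_pos hη)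
  refine ⟨min θp θq, lt_min hθp hθq, fun c z w z' w' h h' hz hw ↦ ?_⟩
  have hz0 : 0 < ‖z‖ :=
    pos_of_mul_pos_right (dist_nonneg.trans_lt hz) (lt_min hθp hθq).le
  have hw0 : 0 < ‖w - c‖ :=
    pos_of_mul_pos_right (dist_nonneg.trans_lt hw) (lt_min hθp hθq).le
  have hdist : dist (w - c) (w' - c) = dist w w' := dist_sub_right w w' c
  have hlower := (hp z z' (hz.trans_le (by gcongr; exact min_le_left _ _))).1
  have hupper := (hq (w - c) (w' - c)
    (hdist.trans_lt (hw.trans_le (by gcongr; exact min_le_right _ _)))).2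
  rw [hdist, show (w - c) ^ q = z ^ p from h, show (w' - c) ^ q = z' ^ p from h'] at hupper
  set B := q * ‖w - c‖ ^ (q - 1)
  have hq0 : (0 : ℝ) < q := Nat.cast_pos.2 (NeZero.pos q)
  have hB : 0 < B := by positivity
  have hderiv : B * ‖branchDeriv p q c z w‖ = p * ‖z‖ ^ (p - 1) := by
    have hnorm : ‖w - c‖ ^ q = ‖z‖ ^ p := by
      rw [← norm_pow, ← norm_pow, show (w - c) ^ q = z ^ p from h]
    rw [← pow_sub_one_mul (NeZero.ne q), ← pow_sub_one_mul (NeZero.ne p)] at hnorm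
    rw [branchDeriv, norm_div, norm_mul, norm_mul, Complex.norm_natCast, Complex.norm_natCast,
      mul_div_assoc', div_eq_iff (by positivity)]
    linear_combination (q : ℝ) * p * hnorm
  refine le_of_mul_le_mul_left ?_ hB
  calc B * (dist z z' * ‖branchDeriv p q c z w‖) = p * ‖z‖ ^ (p - 1) * dist z z' := by
        rw [← hderiv]
        ring
    _ ≤ Real.exp (η / 2) * (Real.exp (η / 2) * (B * dist w w')) := hlower.trans (by gcongr)
    _ = B * (Real.exp η * dist w w') := by
        rw [← mul_assoc, ← Real.exp_add, add_halves]
        ring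

namespace IsTrappingDomain

variable {U : Set ℂ} {ε R : ℝ} {x : ℕ → ℂ}

theorem ball_subset_of_mem_juliaSet (hU : IsTrappingDomain p q c U ε R) {z : ℂ}
    (hz : z ∈ juliaSet p q c) : ball z ε ⊆ U := by
  obtain ⟨w, hw, h⟩ := hU.juliaSet_subset_preimage hz
  exact hU.ball_subset z w h (hU.juliaSet_subset hw)

theorem exists_dist_mul_norm_multiplier_le [NeZero p] [NeZero q]
    (hU : IsTrappingDomain p q c U ε R) {η : ℝ} (hη : 0 < η) :
    ∃ δ > 0, ∀ x ∈ orbitSpace p q c, ∀ y ∈ orbitSpace p q c, ∀ n : ℕ,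
      (∀ i ≤ n, dist (x i) (y i) < δ) →
        dist (x 0) (y 0) * ‖multiplier p q c n x‖ ≤ Real.exp (η * n) * dist (x n) (y n) := by
  obtain ⟨θ, hθ, hbranch⟩ := exists_dist_mul_norm_branchDeriv_le (p := p) (q := q) hη
  obtain ⟨r, hr, hrJ⟩ := hU.exists_le_norm
  have hεJ : ∀ w ∈ juliaSet p q c, ε ≤ ‖w - c‖ := by
    intro w hw
    by_contra! hlt
    exact hU.notMem (hU.ball_subset_of_mem_juliaSet hw (by rwa [mem_ball', dist_eq_norm]))
  refine ⟨min (θ * r) (θ * ε), lt_min (mul_pos hθ hr) (mul_pos hθ hU.margin_pos),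
    fun x hx y hy n ↦ ?_⟩
  induction n generalizing x y with
  | zero => simp [multiplier]
  | succ n ih =>
    intro hclose
    have htail := ih (shift x) (mapsTo_shift p q c hx) (shift y) (mapsTo_shift p q c hy)
      fun i hi ↦ hclose (i + 1) (Nat.succ_le_succ hi)
    have hhead := hbranch c (x 0) (x 1) (y 0) (y 1) (hx.1 0) (hy.1 0)
      ((hclose 0 (Nat.zero_le _)).trans_le ((min_le_left _ _).trans
        (mul_le_mul_of_nonneg_left (hrJ _ (hx.2 0)) hθ.le)))
      ((hclose 1 (Nat.succ_le_succ n.zero_le)).trans_le ((min_le_right _ _).trans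
        (mul_le_mul_of_nonneg_left (hεJ _ (hx.2 1)) hθ.le)))
    rw [multiplier_succ, norm_mul]
    calc dist (x 0) (y 0) * (‖multiplier p q c n (shift x)‖ * ‖branchDeriv p q c (x 0) (x 1)‖)
        = dist (x 0) (y 0) * ‖branchDeriv p q c (x 0) (x 1)‖ *
            ‖multiplier p q c n (shift x)‖ := by ring
      _ ≤ Real.exp η * dist (x 1) (y 1) * ‖multiplier p q c n (shift x)‖ := by gcongr
      _ = Real.exp η * (dist (x 1) (y 1) * ‖multiplier p q c n (shift x)‖) := mul_assoc _ _ _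
      _ ≤ Real.exp η * (Real.exp (η * n) * dist (x (n + 1)) (y (n + 1))) :=
          mul_le_mul_of_nonneg_left htail (Real.exp_pos η).le
      _ = Real.exp (η * (n + 1 : ℕ)) * dist (x (n + 1)) (y (n + 1)) := by
          rw [← mul_assoc, ← Real.exp_add]
          push_cast
          ring_nf

theorem le_norm_multiplier_of_mem_orbitSpace [NeZero p] [NeZero q]
    (hU : IsTrappingDomain p q c U ε R) (hx : x ∈ orbitSpace p q c) (n : ℕ) :
    ε / R * (1 + ε / R) ^ n ≤ ‖multiplier p q c n x‖ :=
  hU.le_norm_multiplier hU.margin_pos (hx.1.isFiniteOrbit n)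
    (hU.ball_subset_of_mem_juliaSet (hx.2 n))

theorem norm_multiplier_pos [NeZero p] [NeZero q] (hU : IsTrappingDomain p q c U ε R)
    (hx : x ∈ orbitSpace p q c) (n : ℕ) : 0 < ‖multiplier p q c n x‖ :=
  (mul_pos (div_pos hU.margin_pos hU.bound_pos) (pow_pos (zero_lt_one.trans hU.one_lt) n)).trans_le
    (hU.le_norm_multiplier_of_mem_orbitSpace hx n)

theorem exists_tendsto_zero_exp_div_norm_multiplier_le [NeZero p] [NeZero q]
    (hU : IsTrappingDomain p q c U ε R) {η : ℝ} (hη : η < Real.log (1 + ε / R)) :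
    ∃ r : ℕ → ℝ, Tendsto r atTop (𝓝 0) ∧ ∀ x ∈ orbitSpace p q c, ∀ n : ℕ,
      Real.exp (η * n) / ‖multiplier p q c n x‖ ≤ r n := by
  have hC : 0 < ε / R := div_pos hU.margin_pos hU.bound_pos
  have hΛ : 0 < 1 + ε / R := zero_lt_one.trans hU.one_lt
  have hlt : Real.exp η / (1 + ε / R) < 1 := (div_lt_one hΛ).2 ((Real.lt_log_iff_exp_lt hΛ).1 hη)
  refine ⟨fun n ↦ (ε / R)⁻¹ * (Real.exp η / (1 + ε / R)) ^ n, ?_, fun x hx n ↦ ?_⟩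
  · simpa using (tendsto_pow_atTop_nhds_zero_of_lt_one (by positivity) hlt).const_mul (ε / R)⁻¹
  · calc Real.exp (η * n) / ‖multiplier p q c n x‖
        ≤ Real.exp (η * n) / (ε / R * (1 + ε / R) ^ n) := by
          gcongr
          exact hU.le_norm_multiplier_of_mem_orbitSpace hx n
      _ = (ε / R)⁻¹ * (Real.exp η / (1 + ε / R)) ^ n := by
          rw [mul_comm η, Real.exp_nat_mul, div_pow]
          field_simp

theorem exists_expansive [NeZero p] [NeZero q] (hU : IsTrappingDomain p q c U ε R) :
    ∃ δ > 0, ∀ ρ > 0, ∃ m : ℕ, ∀ x ∈ orbitSpace p q c, ∀ y ∈ orbitSpace p q c,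
      (∀ i ≤ m, dist (x i) (y i) < δ) → dist (x 0) (y 0) < ρ := by
  have hlog : 0 < Real.log (1 + ε / R) := Real.log_pos hU.one_lt
  obtain ⟨δ, hδ, hdist⟩ := hU.exists_dist_mul_norm_multiplier_le (half_pos hlog)
  obtain ⟨r, hr, hrle⟩ := hU.exists_tendsto_zero_exp_div_norm_multiplier_le (half_lt_self hlog)
  refine ⟨δ, hδ, fun ρ hρ ↦ ?_⟩
  obtain ⟨m, hm⟩ := (hr.eventually_lt_const (div_pos hρ hδ)).exists
  refine ⟨m, fun x hx y hy hxy ↦ ?_⟩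
  calc dist (x 0) (y 0)
      ≤ Real.exp (Real.log (1 + ε / R) / 2 * m) * δ / ‖multiplier p q c m x‖ := by
        rw [le_div_iff₀ (hU.norm_multiplier_pos hx m)]
        refine (hdist x hx y hy m hxy).trans ?_
        gcongr
        exact (hxy m le_rfl).le
    _ ≤ r m * δ := by
        rw [mul_div_right_comm]
        gcongr
        exact hrle x hx m
    _ < ρ := (lt_div_iff₀ hδ).1 hm

/-! ### The pressure function -/

theorem pressureFunction_zero_pos [NeZero p] [NeZero q] (hU : IsTrappingDomain p q c U ε R)
    (hp : 1 < p) : 0 < pressureFunction p q c 0 := by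
  obtain ⟨η, hη, hE⟩ := hU.exists_separated hp
  calc (0 : EReal) < ENNReal.log 2 := ENNReal.zero_lt_log_iff.2 (by norm_num)
    _ = ExpGrowth.expGrowthSup fun n ↦ 2 ^ n := ExpGrowth.expGrowthSup_pow.symm
    _ ≤ ExpGrowth.expGrowthSup (partitionFunction shift (orbitSpace p q c)
          (fun z ↦ (0 : ℝ) * geometricPotential p q c z) (initialEntourage (η / 2))) := by
        refine ExpGrowth.expGrowthSup_monotone fun n ↦ ?_
        obtain ⟨E, hcard, hEX, hsep⟩ := hE n
        refine le_trans (le_of_eq ?_) (sum_le_partitionFunction (isDynNetIn_of_separated hEX hsep))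
        simp [birkhoffSum, hcard]
    _ ≤ pressureFunction p q c 0 :=
        expGrowthSup_partitionFunction_le (initialEntourage_mem_uniformity (half_pos hη)) _

theorem pressureFunction_zero_lt_top [NeZero p] [NeZero q]
    (hU : IsTrappingDomain p q c U ε R) : pressureFunction p q c 0 < ⊤ := by
  obtain ⟨δ, hδ, hexp⟩ := hU.exists_expansive
  have hentropy : pressureFunction p q c 0 = Dynamics.coverEntropy shift (orbitSpace p q c) := by
    simp only [pressureFunction, zero_mul, topologicalPressure_zero]
  rw [hentropy]
  refine coverEntropy_lt_top_of_expansive hU.isCompact_orbitSpace (mapsTo_shift p q c)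
    (initialEntourage_mem_uniformity (half_pos hδ)) fun W hW ↦ ?_
  obtain ⟨k, ρ, hρ, hkW⟩ := exists_dist_lt_imp_mem hW
  obtain ⟨m, hm⟩ := hexp ρ hρ
  refine ⟨k + m + 1, fun x hx y hy hxy ↦ hkW x y fun i hi ↦ ?_⟩
  have hclose := dist_lt_of_mem_dynEntourage_comp (Nat.succ_ne_zero _) hxy
  simpa [shift_iterate_apply] using hm _ (shift_iterate_mem_orbitSpace hx i) _
    (shift_iterate_mem_orbitSpace hy i) fun j hj ↦ by
      rw [shift_iterate_apply, shift_iterate_apply]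
      exact hclose _ (by lia)

theorem birkhoffSum_const_mul_geometricPotential [NeZero p] [NeZero q]
    (hU : IsTrappingDomain p q c U ε R) (hx : x ∈ orbitSpace p q c) (t : ℝ) (n : ℕ) :
    birkhoffSum shift (fun z ↦ t * geometricPotential p q c z) n x =
      -(t * Real.log ‖multiplier p q c n x‖) := by
  have hne := norm_pos_iff.1 (hU.norm_multiplier_pos hx n)
  rw [multiplier, Finset.prod_ne_zero_iff] at hne
  rw [multiplier, norm_prod, Real.log_prod fun i hi ↦ norm_ne_zero_iff.2 (hne i hi)]
  simp [birkhoffSum, geometricPotential, shift_iterate_apply, add_comm 1, Finset.mul_sum]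

theorem mul_add_le_log_norm_multiplier [NeZero p] [NeZero q]
    (hU : IsTrappingDomain p q c U ε R) (hx : x ∈ orbitSpace p q c) (n : ℕ) :
    Real.log (1 + ε / R) * n + Real.log (ε / R) ≤ Real.log ‖multiplier p q c n x‖ := by
  have hC : 0 < ε / R := div_pos hU.margin_pos hU.bound_pos
  have hΛ : 0 < (1 + ε / R) ^ n := pow_pos (zero_lt_one.trans hU.one_lt) n
  calc Real.log (1 + ε / R) * n + Real.log (ε / R) = Real.log (ε / R * (1 + ε / R) ^ n) := by
        rw [Real.log_mul hC.ne' hΛ.ne', Real.log_pow]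
        ring
    _ ≤ Real.log ‖multiplier p q c n x‖ :=
        Real.log_le_log (mul_pos hC hΛ) (hU.le_norm_multiplier_of_mem_orbitSpace hx n)

theorem exists_log_norm_multiplier_le [NeZero p] [NeZero q]
    (hU : IsTrappingDomain p q c U ε R) :
    ∃ β : ℝ, ∀ x ∈ orbitSpace p q c, ∀ n : ℕ, Real.log ‖multiplier p q c n x‖ ≤ β * n := by
  obtain ⟨r, hr, hrJ⟩ := hU.exists_le_norm
  obtain ⟨B, hB⟩ := hU.isCompact_juliaSet.isBounded.exists_norm_le
  have hq : (0 : ℝ) < q := Nat.cast_pos.2 (NeZero.pos q)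
  have hbranch : ∀ x ∈ orbitSpace p q c, ∀ i,
      ‖branchDeriv p q c (x i) (x (i + 1))‖ ≤ p * (B + ‖c‖) / (q * r) := by
    intro x hx i
    have hw : ‖x (i + 1) - c‖ ≤ B + ‖c‖ := (norm_sub_le _ _).trans (by gcongr; exact hB _ (hx.2 _))
    have hBc : 0 ≤ B + ‖c‖ := (norm_nonneg _).trans hw
    rw [branchDeriv, norm_div, norm_mul, norm_mul, Complex.norm_natCast, Complex.norm_natCast]
    gcongr
    exact hrJ _ (hx.2 i)
  refine ⟨Real.log (p * (B + ‖c‖) / (q * r)), fun x hx n ↦ ?_⟩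
  rw [mul_comm, ← Real.log_pow]
  refine Real.log_le_log (hU.norm_multiplier_pos hx n) ?_
  rw [multiplier, norm_prod]
  exact (Finset.prod_le_prod (fun _ _ ↦ norm_nonneg _) fun i _ ↦ hbranch x hx i).trans_eq
    (by rw [Finset.prod_const, Finset.card_range])

theorem exists_pressureFunction_eq_zero [NeZero p] [NeZero q]
    (hU : IsTrappingDomain p q c U ε R) (hp : 1 < p) :
    ∃ t : ℝ, 0 < t ∧ pressureFunction p q c t = 0 ∧
      StrictAntiOn (pressureFunction p q c) (Set.Ici 0) := by
  obtain ⟨β, hβ⟩ := hU.exists_log_norm_multiplier_le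
  refine exists_eq_zero_and_strictAntiOn (Real.log_pos hU.one_lt)
    (hU.pressureFunction_zero_pos hp) hU.pressureFunction_zero_lt_top (β := β)
    (fun s t _ hst ↦ topologicalPressure_le_add (b := -((t - s) * Real.log (ε / R)))
      fun x hx n ↦ ?_)
    (fun s t _ hst ↦ topologicalPressure_le_add (b := 0) fun x hx n ↦ ?_)
  · rw [hU.birkhoffSum_const_mul_geometricPotential hx,
      hU.birkhoffSum_const_mul_geometricPotential hx]
    linarith [mul_le_mul_of_nonneg_left (hU.mul_add_le_log_norm_multiplier hx n)
      (sub_nonneg.2 hst)]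
  · rw [hU.birkhoffSum_const_mul_geometricPotential hx,
      hU.birkhoffSum_const_mul_geometricPotential hx]
    linarith [mul_le_mul_of_nonneg_left (hβ x hx n) (sub_nonneg.2 hst)]

end IsTrappingDomain

end Correspondence

/-! ### The dimension of the Julia set -/

theorem dimH_le_of_sum_ediam_rpow_le {α X : Type*} [EMetricSpace X] {s : Set X} {d : NNReal}
    {C : ENNReal} (hC : C ≠ ⊤) {r : ℕ → ENNReal} (hr : Tendsto r atTop (𝓝 0))
    {E : ℕ → Finset α} {D : ℕ → α → Set X} (hdiam : ∀ᶠ n in atTop, ∀ e ∈ E n, ediam (D n e) ≤ r n)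
    (hcover : ∀ᶠ n in atTop, s ⊆ ⋃ e ∈ E n, D n e)
    (hsum : ∀ᶠ n in atTop, ∑ e ∈ E n, ediam (D n e) ^ (d : ℝ) ≤ C) : dimH s ≤ d := by
  borelize X
  refine dimH_le_of_hausdorffMeasure_ne_top (ne_top_of_le_ne_top hC ?_)
  calc MeasureTheory.Measure.hausdorffMeasure d s
      ≤ liminf (fun n ↦ ∑ e : E n, ediam (D n e) ^ (d : ℝ)) atTop :=
        MeasureTheory.Measure.hausdorffMeasure_le_liminf_sum d s r hr (fun n (e : E n) ↦ D n e)
          (hdiam.mono fun n h e ↦ h e e.2)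
          (hcover.mono fun n h ↦ by simpa only [Set.iUnion_subtype] using h)
    _ ≤ C := by
        refine liminf_le_of_frequently_le' (hsum.frequently.mono fun n h ↦ ?_)
        rwa [Finset.sum_coe_sort (E n) fun e ↦ ediam (D n e) ^ (d : ℝ)]

namespace Correspondence

variable {p q : ℕ} {c : ℂ} {U : Set ℂ} {ε R : ℝ}

/-- The set of the initial points of the orbits in the Julia set that stay `δ`-close to `e` up to
time `n`. These sets cover the Julia set when `e` runs over a dynamical net, and the expansion of
the correspondence bounds their diameters. -/
def initialPoints (p q : ℕ) (c : ℂ) (δ : ℝ) (n : ℕ) (e : ℕ → ℂ) : Set ℂ :=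
  (fun x ↦ x 0) '' {x ∈ orbitSpace p q c | ∀ i ≤ n, dist (e i) (x i) < δ}

namespace IsTrappingDomain

theorem exists_ediam_initialPoints_le [NeZero p] [NeZero q] (hU : IsTrappingDomain p q c U ε R)
    {η : ℝ} (hη : 0 < η) :
    ∃ δ > 0, ∀ e ∈ orbitSpace p q c, ∀ n : ℕ, ediam (initialPoints p q c δ n e) ≤
      ENNReal.ofReal (2 * δ * (Real.exp (η * n) / ‖multiplier p q c n e‖)) := by
  obtain ⟨δ, hδ, hdist⟩ := hU.exists_dist_mul_norm_multiplier_le hη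
  refine ⟨δ, hδ, fun e he n ↦ ?_⟩
  have hle : ∀ z ∈ initialPoints p q c δ n e,
      dist (e 0) z ≤ δ * (Real.exp (η * n) / ‖multiplier p q c n e‖) := by
    rintro _ ⟨x, ⟨hx, hex⟩, rfl⟩
    rw [← mul_div_assoc, le_div_iff₀ (hU.norm_multiplier_pos he n), mul_comm δ]
    refine (hdist e he x hx n hex).trans ?_
    gcongr
    exact (hex n le_rfl).le
  refine ediam_le_of_forall_dist_le fun z hz w hw ↦ ?_
  linarith [dist_triangle_left z w (e 0), hle z hz, hle w hw]

theorem exists_net_juliaSet_subset_iUnion_initialPoints (hU : IsTrappingDomain p q c U ε R)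
    {δ : ℝ} (hδ : 0 < δ) {n : ℕ} (hn : n ≠ 0) :
    ∃ E : Finset (ℕ → ℂ), Dynamics.IsDynNetIn shift (orbitSpace p q c) (initialEntourage (δ / 2)) n
      (E : Set (ℕ → ℂ)) ∧ juliaSet p q c ⊆ ⋃ e ∈ E, initialPoints p q c δ n e := by
  have hV := initialEntourage_mem_uniformity (half_pos hδ)
  have := isRefl_of_mem_uniformity hV
  obtain ⟨E, hnet, hcover⟩ := exists_isDynNetIn_isDynCoverOf
    ((Dynamics.netMaxcard_le_coverMincard shift (orbitSpace p q c) n).trans_lt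
      (Dynamics.coverMincard_finite_of_isCompact_invariant hU.isCompact_orbitSpace
        (mapsTo_shift p q c) hV n))
  refine ⟨E, hnet, fun z hz ↦ ?_⟩
  obtain ⟨x, hx, rfl⟩ := hU.exists_mem_orbitSpace hz
  obtain ⟨e, he, hxe⟩ := hcover hx
  refine Set.mem_biUnion he ⟨x, ⟨hx, fun i hi ↦ ?_⟩, rfl⟩
  rw [dist_comm]
  exact dist_lt_of_mem_dynEntourage_comp hn hxe i hi

/-- On a net of the `n`-th orbits, the sum of the `t`-th powers of the diameters is a partition
function of the potential `t * φ_c`, up to a factor that the pressure absorbs. -/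
theorem sum_ediam_rpow_le [NeZero p] [NeZero q] (hU : IsTrappingDomain p q c U ε R)
    {t b η δ : ℝ} (ht : 0 < t) (hδ : 0 < δ) (htη : t * η ≤ b) {n : ℕ} {V : SetRel (ℕ → ℂ) (ℕ → ℂ)}
    {E : Finset (ℕ → ℂ)} {D : (ℕ → ℂ) → Set ℂ}
    (hE : Dynamics.IsDynNetIn shift (orbitSpace p q c) V n (E : Set (ℕ → ℂ)))
    (hdiam : ∀ e ∈ E, ediam (D e) ≤
      ENNReal.ofReal (2 * δ * (Real.exp (η * n) / ‖multiplier p q c n e‖)))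
    (hZ : partitionFunction shift (orbitSpace p q c) (fun z ↦ t * geometricPotential p q c z) V n ≤
      ENNReal.ofReal (Real.exp (-b * n))) :
    ∑ e ∈ E, ediam (D e) ^ t ≤ ENNReal.ofReal ((2 * δ) ^ t) := by
  set S := birkhoffSum shift (fun z ↦ t * geometricPotential p q c z) n with hS
  have hterm : ∀ e ∈ E, ediam (D e) ^ t ≤
      ENNReal.ofReal ((2 * δ) ^ t * Real.exp (b * n)) * ENNReal.ofReal (Real.exp (S e)) := by
    intro e he
    have hm := hU.norm_multiplier_pos (hE.1 he) n
    have hexp : Real.exp (S e) = (‖multiplier p q c n e‖ ^ t)⁻¹ := by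
      rw [hS, hU.birkhoffSum_const_mul_geometricPotential (hE.1 he), Real.exp_neg, mul_comm,
        Real.exp_mul, Real.exp_log hm]
    rw [← ENNReal.ofReal_mul (by positivity), hexp]
    refine (ENNReal.rpow_le_rpow (hdiam e he) ht.le).trans ?_
    rw [ENNReal.ofReal_rpow_of_nonneg (by positivity) ht.le, Real.mul_rpow (by positivity)
      (by positivity), Real.div_rpow (Real.exp_pos _).le hm.le, ← Real.exp_mul,
      ← div_eq_mul_inv, ← mul_div_assoc]
    gcongr ENNReal.ofReal (_ * Real.exp ?_ / _)
    linarith [mul_le_mul_of_nonneg_right htη n.cast_nonneg]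
  calc ∑ e ∈ E, ediam (D e) ^ t
      ≤ ∑ e ∈ E, ENNReal.ofReal ((2 * δ) ^ t * Real.exp (b * n)) *
          ENNReal.ofReal (Real.exp (S e)) := Finset.sum_le_sum hterm
    _ ≤ ENNReal.ofReal ((2 * δ) ^ t * Real.exp (b * n)) * ENNReal.ofReal (Real.exp (-b * n)) := by
        rw [← Finset.mul_sum]
        gcongr
        exact (sum_le_partitionFunction hE).trans hZ
    _ = ENNReal.ofReal ((2 * δ) ^ t) := by
        rw [← ENNReal.ofReal_mul (by positivity), mul_assoc, ← Real.exp_add, neg_mul,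
          add_neg_cancel, Real.exp_zero, mul_one]

theorem dimH_juliaSet_le [NeZero p] [NeZero q] (hU : IsTrappingDomain p q c U ε R) {t : ℝ}
    (ht : 0 < t) (hneg : pressureFunction p q c t < 0) :
    dimH (juliaSet p q c) ≤ ENNReal.ofReal t := by
  obtain ⟨b, hb, hb0⟩ := EReal.lt_iff_exists_real_btwn.1 hneg
  have hb0 : 0 < -b := neg_pos.2 (EReal.coe_neg'.1 hb0)
  obtain ⟨η, hη, hηmin⟩ := exists_between (lt_min (Real.log_pos hU.one_lt) (div_pos hb0 ht))
  obtain ⟨δ, hδ, hdiam⟩ := hU.exists_ediam_initialPoints_le hη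
  obtain ⟨r, hr, hrle⟩ :=
    hU.exists_tendsto_zero_exp_div_norm_multiplier_le (hηmin.trans_le (min_le_left _ _))
  have htη : t * η ≤ -b := by
    rw [← le_div_iff₀' ht]
    exact (hηmin.trans_le (min_le_right _ _)).le
  choose! E hE hcover using fun n (hn : n ≠ 0) ↦
    hU.exists_net_juliaSet_subset_iUnion_initialPoints hδ hn
  have hZ := eventually_partitionFunction_le_exp
    (initialEntourage_mem_uniformity (half_pos hδ)) hb
  refine dimH_le_of_sum_ediam_rpow_le (E := E) (D := initialPoints p q c δ)
    (r := fun n ↦ ENNReal.ofReal (2 * δ * r n)) (C := ENNReal.ofReal ((2 * δ) ^ t))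
    ENNReal.ofReal_ne_top ?_ ?_ ((eventually_ne_atTop 0).mono hcover) ?_
  · simpa using ENNReal.tendsto_ofReal (hr.const_mul (2 * δ))
  · filter_upwards [eventually_ne_atTop 0] with n hn e he
    refine (hdiam e ((hE n hn).1 he) n).trans (ENNReal.ofReal_le_ofReal ?_)
    gcongr
    exact hrle e ((hE n hn).1 he) n
  · filter_upwards [eventually_ne_atTop 0, hZ] with n hn hZn
    rw [Real.coe_toNNReal t ht.le]
    exact hU.sum_ediam_rpow_le ht hδ htη (hE n hn) (fun e he ↦ hdiam e ((hE n hn).1 he) n)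
      (by rwa [neg_neg])

theorem exists_isBowenParameter [NeZero p] [NeZero q] (hU : IsTrappingDomain p q c U ε R)
    (hp : 1 < p) :
    ∃ t : ℝ, IsBowenParameter p q c t ∧ dimH (juliaSet p q c) ≤ ENNReal.ofReal t := by
  obtain ⟨t, ht, hzero, hanti⟩ := hU.exists_pressureFunction_eq_zero hp
  refine ⟨t, ⟨ht, fun s hs ↦ ⟨fun h ↦ hanti.injOn hs ht.le (h.trans hzero.symm), ?_⟩⟩, ?_⟩
  · rintro rfl
    exact hzero
  · refine ge_of_tendsto ((ENNReal.continuous_ofReal.tendsto t).mono_left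
      (nhdsWithin_le_nhds (s := Set.Ioi t))) ?_
    filter_upwards [self_mem_nhdsWithin] with s hs
    have hs0 : 0 < s := ht.trans hs
    exact hU.dimH_juliaSet_le hs0 ((hanti ht.le hs0.le hs).trans_eq hzero)

end IsTrappingDomain

end Correspondence

namespace Correspondence

variable {p q : ℕ} {c : ℂ} {R : ℝ} {M : ℕ}

/-! ### Escape to infinity -/

/-- `R` is an escape radius: images of points outside the disc `|z| < R` are farther from `0` by at
least `1`, so that every orbit leaving this disc diverges to infinity. -/
def IsEscapeRadius (p q : ℕ) (c : ℂ) (R : ℝ) : Prop :=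
  ∀ z w, IsImage p q c z w → R ≤ ‖z‖ → ‖z‖ + 1 ≤ ‖w‖

/-- The points that have an orbit of length `M` ending in the closed disc of radius `R`. For an
escape radius `R` such an orbit stays in the disc, and as `M` grows these sets decrease to the set
of the points with a bounded orbit. -/
def nonescaping (p q : ℕ) (c : ℂ) (R : ℝ) (M : ℕ) : Set ℂ :=
  (graph p q c).preimage^[M] (closedBall 0 R)

theorem IsImage.norm_pow_eq {z w : ℂ} (h : IsImage p q c z w) : ‖w - c‖ ^ q = ‖z‖ ^ p := by
  rw [← norm_pow, ← norm_pow]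
  exact congrArg norm h

theorem isEscapeRadius_of_le (hq : q ≠ 0) (hpq : q < p) (hR : 2 ^ q ≤ R) (hc : ‖c‖ + 1 ≤ R) :
    IsEscapeRadius p q c R := by
  intro z w h hz
  have h1 : 1 ≤ ‖z‖ := (one_le_pow₀ one_le_two).trans (hR.trans hz)
  have hpow : (2 * ‖z‖) ^ q ≤ ‖w - c‖ ^ q :=
    calc (2 * ‖z‖) ^ q = 2 ^ q * ‖z‖ ^ q := mul_pow _ _ _
      _ ≤ ‖z‖ * ‖z‖ ^ q := by gcongr; exact hR.trans hz
      _ = ‖z‖ ^ (q + 1) := (pow_succ' _ _).symm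
      _ ≤ ‖z‖ ^ p := pow_le_pow_right₀ h1 hpq
      _ = ‖w - c‖ ^ q := h.norm_pow_eq.symm
  linarith [le_of_pow_le_pow_left₀ hq (norm_nonneg _) hpow, norm_sub_le w c]

theorem exists_eventually_isEscapeRadius (hq : q ≠ 0) (hpq : q < p) (a : ℂ) :
    ∃ R, ∀ᶠ c in 𝓝 a, IsEscapeRadius p q c R := by
  refine ⟨max (2 ^ q) (‖a‖ + 2), ?_⟩
  have hnear : ∀ᶠ c in 𝓝 a, ‖c‖ < ‖a‖ + 1 :=
    continuous_norm.continuousAt.eventually_lt continuousAt_const (lt_add_one _)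
  filter_upwards [hnear] with c hc
  exact isEscapeRadius_of_le hq hpq (le_max_left _ _)
    (le_trans (by linarith) (le_max_right _ _))

theorem isOpen_setOf_mem_iterate_preimage [NeZero q] {S : Set ℂ} (hS : IsOpen S) (M : ℕ) :
    IsOpen {v : ℂ × ℂ | v.2 ∈ (graph p q v.1).preimage^[M] S} := by
  induction M with
  | zero => exact hS.preimage continuous_snd
  | succ M ih =>
    simp only [Function.iterate_succ_apply']
    rw [isOpen_iff_mem_nhds]
    rintro ⟨c, z⟩ ⟨w, hw, hzw⟩
    obtain ⟨δ, hδ, hball⟩ := Metric.isOpen_iff.1 ih (c, w) hw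
    have hpow : ∀ᶠ v : ℂ × ℂ in 𝓝 (c, z), ‖(w - c) ^ q - v.2 ^ p‖ < (δ / 2) ^ q := by
      refine ContinuousAt.eventually_lt (by fun_prop) continuousAt_const ?_
      rw [show (w - c) ^ q = z ^ p from hzw, sub_self, norm_zero]
      positivity
    have hparam : ∀ᶠ v : ℂ × ℂ in 𝓝 (c, z), dist v.1 c < δ / 2 :=
      ContinuousAt.eventually_lt (by fun_prop) continuousAt_const (by simpa using half_pos hδ)
    filter_upwards [hpow, hparam] with v hv hvc
    obtain ⟨u, hu, hwu⟩ := exists_pow_eq_norm_sub_pow_le (NeZero.ne q) (v.2 ^ p) (w - c)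
    have hclose : dist u (w - c) < δ / 2 := by
      rw [dist_comm, dist_eq_norm]
      exact lt_of_pow_lt_pow_left₀ q (half_pos hδ).le (hwu.trans_lt hv)
    suffices hmem : (v.1, v.1 + u) ∈ ball (c, w) δ from
      ⟨v.1 + u, hball hmem, by simpa [graph, IsImage] using hu⟩
    rw [mem_ball, Prod.dist_eq, max_lt_iff]
    refine ⟨hvc.trans (half_lt_self hδ), ?_⟩
    have := dist_add_add_le v.1 u c (w - c)
    rw [add_sub_cancel] at this
    linarith

theorem isBounded_range_mod {α : Type*} [PseudoMetricSpace α] {n : ℕ} (hn : 0 < n) (x : ℕ → α) :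
    Bornology.IsBounded (Set.range fun i ↦ x (i % n)) := by
  refine ((Set.finite_Iio n).image x).isBounded.subset ?_
  rintro _ ⟨i, rfl⟩
  exact ⟨i % n, Nat.mod_lt _ hn, rfl⟩

namespace IsEscapeRadius

theorem norm_lt_of_isBounded (hR : IsEscapeRadius p q c R) {x : ℕ → ℂ} (hx : IsOrbit p q c x)
    (hb : Bornology.IsBounded (Set.range x)) (i : ℕ) : ‖x i‖ < R := by
  by_contra! hi
  have hgrow (k : ℕ) : ‖x i‖ + k ≤ ‖x (i + k)‖ := by
    induction k with
    | zero => simp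
    | succ k ih =>
      have := hR _ _ (hx (i + k)) (by linarith [k.cast_nonneg (α := ℝ)])
      push_cast
      linarith!
  obtain ⟨C, hC⟩ := hb.exists_norm_le
  obtain ⟨k, hk⟩ := exists_nat_gt C
  linarith [hgrow k, hC _ (Set.mem_range_self (i + k)), norm_nonneg (x i)]

theorem mem_iterate_preimage_ball (hR : IsEscapeRadius p q c R) {x : ℕ → ℂ}
    (hx : IsOrbit p q c x) (hb : Bornology.IsBounded (Set.range x)) (M : ℕ) :
    x 0 ∈ (graph p q c).preimage^[M] (ball 0 R) :=
  mem_iterate_preimage_graph.2 ⟨x, hx.isFiniteOrbit M, rfl,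
    mem_ball_zero_iff.2 (hR.norm_lt_of_isBounded hx hb M)⟩

theorem preimage_closedBall_subset_ball (hR : IsEscapeRadius p q c R) :
    (graph p q c).preimage (closedBall 0 R) ⊆ ball 0 R := by
  rintro z ⟨w, hw, h⟩
  rw [mem_closedBall_zero_iff] at hw
  rw [mem_ball_zero_iff]
  by_contra! hz
  linarith [hR z w h hz]

theorem nonescaping_succ_subset (hR : IsEscapeRadius p q c R) (M : ℕ) :
    nonescaping p q c R (M + 1) ⊆ (graph p q c).preimage^[M] (ball 0 R) := by
  rw [nonescaping, Function.iterate_succ_apply]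
  exact SetRel.preimage_mono.iterate M hR.preimage_closedBall_subset_ball

theorem antitone_nonescaping (hR : IsEscapeRadius p q c R) : Antitone (nonescaping p q c R) :=
  antitone_nat_of_succ_le fun M ↦
    (hR.nonescaping_succ_subset M).trans (SetRel.preimage_mono.iterate M ball_subset_closedBall)

theorem nonescaping_subset_closedBall (hR : IsEscapeRadius p q c R) (M : ℕ) :
    nonescaping p q c R M ⊆ closedBall 0 R :=
  hR.antitone_nonescaping M.zero_le

end IsEscapeRadius

theorem isClosed_setOf_mem_nonescaping {C : Set ℂ} (hC : IsClosed C)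
    (hR : ∀ c ∈ C, IsEscapeRadius p q c R) (M : ℕ) :
    IsClosed {v : ℂ × ℂ | v.1 ∈ C ∧ v.2 ∈ nonescaping p q v.1 R M} := by
  induction M with
  | zero => exact (hC.preimage continuous_fst).inter (isClosed_closedBall.preimage continuous_snd)
  | succ M ih =>
    have hstep : IsClosed {b : (ℂ × ℂ) × ℂ | (b.1.1 ∈ C ∧ b.2 ∈ nonescaping p q b.1.1 R M) ∧
        IsImage p q b.1.1 b.1.2 b.2} :=
      (ih.preimage (f := fun b : (ℂ × ℂ) × ℂ ↦ (b.1.1, b.2)) (by fun_prop)).inter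
        (isClosed_eq (by fun_prop) (by fun_prop))
    convert isClosed_setOf_exists_mem_of_isCompact (isCompact_closedBall (0 : ℂ) R) hstep using 1
    ext ⟨c, z⟩
    simp only [nonescaping, Function.iterate_succ_apply']
    constructor
    · rintro ⟨hc, w, hw, h⟩
      exact ⟨w, (hR c hc).nonescaping_subset_closedBall M hw, ⟨hc, hw⟩, h⟩
    · rintro ⟨w, -, ⟨hc, hw⟩, h⟩
      exact ⟨hc, w, hw, h⟩

namespace IsEscapeRadius

theorem isCompact_nonescaping (hR : IsEscapeRadius p q c R) (M : ℕ) :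
    IsCompact (nonescaping p q c R M) := by
  have hall : ∀ c' ∈ ({c} : Set ℂ), IsEscapeRadius p q c' R := by simpa using hR
  have hcl := (isClosed_setOf_mem_nonescaping isClosed_singleton hall M).preimage
    (f := fun z : ℂ ↦ (c, z)) (by fun_prop)
  simp only [Set.preimage_ofPred_eq, Set.mem_singleton, true_and] at hcl
  exact (isCompact_closedBall 0 R).of_isClosed_subset hcl (hR.nonescaping_subset_closedBall M)

theorem exists_isImage_forall_mem_nonescaping (hR : IsEscapeRadius p q c R) {z : ℂ}
    (hz : ∀ M, z ∈ nonescaping p q c R M) :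
    ∃ w, IsImage p q c z w ∧ ∀ M, w ∈ nonescaping p q c R M := by
  have himage : IsClosed {w | IsImage p q c z w} := isClosed_eq (by fun_prop) (by fun_prop)
  obtain ⟨w, hw⟩ := IsCompact.nonempty_iInter_of_sequence_nonempty_isCompact_isClosed
    (fun M ↦ {w | IsImage p q c z w} ∩ nonescaping p q c R M)
    (fun M ↦ Set.inter_subset_inter_right _ (hR.antitone_nonescaping M.le_succ))
    (fun M ↦ by
      have hzM := hz (M + 1)
      rw [nonescaping, Function.iterate_succ_apply'] at hzM
      obtain ⟨w, hw, h⟩ := hzM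
      exact ⟨w, h, hw⟩)
    ((hR.isCompact_nonescaping 0).inter_left himage)
    (fun M ↦ himage.inter (hR.isCompact_nonescaping M).isClosed)
  rw [Set.mem_iInter] at hw
  exact ⟨w, (hw 0).1, fun M ↦ (hw M).2⟩

theorem exists_isOrbit_isBounded (hR : IsEscapeRadius p q c R) {z : ℂ}
    (hz : ∀ M, z ∈ nonescaping p q c R M) :
    ∃ x, IsOrbit p q c x ∧ x 0 = z ∧ Bornology.IsBounded (Set.range x) := by
  choose! g himage hmem using fun z ↦ hR.exists_isImage_forall_mem_nonescaping (z := z)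
  have hiter (i M : ℕ) : g^[i] z ∈ nonescaping p q c R M := by
    induction i generalizing M with
    | zero => exact hz M
    | succ i ih =>
      rw [Function.iterate_succ_apply']
      exact hmem _ ih M
  refine ⟨fun i ↦ g^[i] z, fun i ↦ ?_, rfl,
    (isBounded_closedBall (x := (0 : ℂ)) (r := R)).subset ?_⟩
  · simp only [Function.iterate_succ_apply']
    exact himage _ (hiter i)
  · rintro _ ⟨i, rfl⟩
    exact hiter i 0

theorem mem_iterate_preimage_ball_of_isRepellingCycle (hR : IsEscapeRadius p q c R) {n : ℕ}
    {z : ℕ → ℂ} (hz : IsRepellingCycle p q c n z) (M i : ℕ) :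
    z (i % n) ∈ (graph p q c).preimage^[M] (ball 0 R) := by
  have hx := IsFiniteOrbit.isOrbit_mod hz.2.1 hz.1 hz.2.2.1
  have hb := isBounded_range_mod hz.1 z
  refine mem_iterate_preimage_graph.2 ⟨fun j ↦ z ((i + j) % n), fun j _ ↦ hx (i + j), rfl, ?_⟩
  exact mem_ball_zero_iff.2 (hR.norm_lt_of_isBounded hx hb (i + M))

/-! ### Construction of trapping domains -/

theorem exists_isTrappingDomain_of_absorbing [NeZero q] (hR : IsEscapeRadius p q c R)
    {B V : Set ℂ} (hB : IsClosed B) (hV : IsOpen V) (hVB : V ⊆ B)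
    (habs : ∀ z ∈ B, ∀ w ∈ nonescaping p q c R M, IsImage p q c z w → w ∈ V)
    (hcrit : c ∈ nonescaping p q c R M → c ∈ B)
    (hne : ((graph p q c).preimage^[M] (ball 0 R) \ B).Nonempty)
    (hcyc : ∀ n z, IsRepellingCycle p q c n z → ∀ i < n, z i ∉ B) :
    ∃ U ε R', IsTrappingDomain p q c U ε R' := by
  set E := (graph p q c).preimage^[M] (ball 0 R)
  have hE : IsOpen E := (isOpen_setOf_mem_iterate_preimage isOpen_ball M).preimage
    (f := fun z : ℂ ↦ (c, z)) (by fun_prop)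
  have hEN : E ⊆ nonescaping p q c R M := SetRel.preimage_mono.iterate M ball_subset_closedBall
  have hER : E ⊆ closedBall 0 R := hEN.trans (hR.nonescaping_subset_closedBall M)
  have hback : (graph p q c).preimage (nonescaping p q c R M \ V) ⊆ E \ B := by
    rintro z ⟨w, ⟨hwN, hwV⟩, h⟩
    refine ⟨hR.nonescaping_succ_subset M ?_, fun hzB ↦ hwV (habs z hzB w hwN h)⟩
    rw [nonescaping, Function.iterate_succ_apply']
    exact ⟨w, hwN, h⟩
  have hcompact : IsCompact ((graph p q c).preimage (nonescaping p q c R M \ V)) :=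
    (isCompact_closedBall (0 : ℂ) R).of_isClosed_subset
      (isClosed_preimage_graph ((hR.isCompact_nonescaping M).diff hV))
      (hback.trans (Set.sdiff_subset.trans hER))
  obtain ⟨ε, hε, hthick⟩ := hcompact.exists_thickening_subset_open (hE.sdiff hB) hback
  obtain ⟨s, hs⟩ := hne
  have hRnonneg : 0 ≤ R := (norm_nonneg s).trans (mem_closedBall_zero_iff.1 (hER hs.1))
  refine ⟨E \ B, ε, 2 * R + 1, hE.sdiff hB, ⟨s, hs⟩, fun hc ↦ hc.2 (hcrit (hEN hc.1)), hε,
    by linarith, fun z hz w hw ↦ ?_, fun z w h hw ↦ ?_, fun n z hz i hi ↦ ⟨?_, hcyc n z hz i hi⟩⟩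
  · have hz0 := mem_closedBall.1 (hER hz.1)
    have hw0 := mem_closedBall.1 (hER hw.1)
    linarith [dist_triangle_right z w 0]
  · have hzback : z ∈ (graph p q c).preimage (nonescaping p q c R M \ V) :=
      ⟨w, ⟨hEN hw.1, fun hwV ↦ hw.2 (hVB hwV)⟩, h⟩
    exact (ball_subset_thickening hzback ε).trans hthick
  · simpa only [Nat.mod_eq_of_lt hi] using hR.mem_iterate_preimage_ball_of_isRepellingCycle hz M i

end IsEscapeRadius

/-- Every branch of `𝐟_c` on the disc `|z - y| ≤ r` whose value lies in `S` maps into the disc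
`|w - y'| < r'` and contracts by a factor `2` in the metrics that give both discs radius `1`. -/
def ContractsDisc (p q : ℕ) (c : ℂ) (S : Set ℂ) (y : ℂ) (r : ℝ) (y' : ℂ) (r' : ℝ) : Prop :=
  ∀ z ∈ closedBall y r, ∀ w ∈ S, IsImage p q c z w →
    w ∈ ball y' r' ∧ ‖branchDeriv p q c z w‖ * r ≤ r' / 2

section AbsorbingDiscs

variable {ι : Type*} {next : ι → ι} {y : ι → ℂ} {ρ : ι → ℝ}

theorem IsOrbit.mem_closedBall_of_contractsDisc {S : Set ℂ} {x : ℕ → ℂ} (hx : IsOrbit p q c x)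
    (hS : ∀ l, x l ∈ S)
    (hdisc : ∀ i, ContractsDisc p q c S (y i) (ρ i) (y (next i)) (ρ (next i))) {i : ι} {j : ℕ}
    (hj : x j ∈ closedBall (y i) (ρ i)) (l : ℕ) :
    x (j + l) ∈ closedBall (y (next^[l] i)) (ρ (next^[l] i)) := by
  induction l with
  | zero => exact hj
  | succ l ih =>
    rw [Function.iterate_succ_apply']
    exact ball_subset_closedBall (hdisc _ _ ih _ (hS _) (hx _)).1

theorem IsOrbit.norm_multiplier_mul_le_of_contractsDisc {S : Set ℂ} {x : ℕ → ℂ}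
    (hx : IsOrbit p q c x) (hS : ∀ l, x l ∈ S)
    (hdisc : ∀ i, ContractsDisc p q c S (y i) (ρ i) (y (next i)) (ρ (next i))) {i : ι}
    (hi : x 0 ∈ closedBall (y i) (ρ i)) (l : ℕ) :
    ‖multiplier p q c l x‖ * ρ i ≤ (1 / 2) ^ l * ρ (next^[l] i) := by
  induction l with
  | zero => simp [multiplier]
  | succ l ih =>
    have hl := hx.mem_closedBall_of_contractsDisc hS hdisc hi l
    rw [zero_add] at hl
    have hcontr := (hdisc _ _ hl _ (hS _) (hx l)).2
    rw [Function.iterate_succ_apply', multiplier, Finset.prod_range_succ, norm_mul]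
    calc ‖multiplier p q c l x‖ * ‖branchDeriv p q c (x l) (x (l + 1))‖ * ρ i
        = ‖multiplier p q c l x‖ * ρ i * ‖branchDeriv p q c (x l) (x (l + 1))‖ := by ring
      _ ≤ (1 / 2) ^ l * ρ (next^[l] i) * ‖branchDeriv p q c (x l) (x (l + 1))‖ := by gcongr
      _ = (1 / 2) ^ l * (‖branchDeriv p q c (x l) (x (l + 1))‖ * ρ (next^[l] i)) := by ring
      _ ≤ (1 / 2) ^ l * (ρ (next (next^[l] i)) / 2) := by gcongr
      _ = (1 / 2) ^ (l + 1) * ρ (next (next^[l] i)) := by ring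

theorem IsRepellingCycle.notMem_of_contractsDisc [Finite ι] {S : Set ℂ} {n : ℕ} {z : ℕ → ℂ}
    (hz : IsRepellingCycle p q c n z) (hS : ∀ l, z (l % n) ∈ S) (hρ : ∀ i, 0 < ρ i)
    (hdisc : ∀ i, ContractsDisc p q c S (y i) (ρ i) (y (next i)) (ρ (next i))) {j : ℕ} (hj : j < n)
    (i : ι) : z j ∉ closedBall (y i) (ρ i) := by
  intro hji
  set x : ℕ → ℂ := fun l ↦ z (l % n)
  have hx : IsOrbit p q c x := IsFiniteOrbit.isOrbit_mod hz.2.1 hz.1 hz.2.2.1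
  obtain ⟨i₀, h₀⟩ : ∃ i₀, x 0 ∈ closedBall (y i₀) (ρ i₀) := by
    have hxj : x j ∈ closedBall (y i) (ρ i) := by simpa only [x, Nat.mod_eq_of_lt hj] using hji
    have hxn := hx.mem_closedBall_of_contractsDisc hS hdisc hxj (n - j)
    rw [Nat.add_sub_cancel' hj.le] at hxn
    exact ⟨_, by simpa [x] using hxn⟩
  obtain ⟨G, hG⟩ := (Set.finite_range ρ).bddAbove
  have hbound (k : ℕ) : ρ i₀ ≤ (1 / 2) ^ k * G :=
    calc ρ i₀ ≤ ‖multiplier p q c n z‖ ^ k * ρ i₀ :=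
          le_mul_of_one_le_left (hρ i₀).le (one_le_pow₀ hz.2.2.2.2.2.le)
      _ = ‖multiplier p q c (k * n) x‖ * ρ i₀ := by
          rw [← norm_pow, multiplier_mod hz.1 hz.2.2.1]
      _ ≤ (1 / 2) ^ (k * n) * ρ (next^[k * n] i₀) :=
          hx.norm_multiplier_mul_le_of_contractsDisc hS hdisc h₀ _
      _ ≤ (1 / 2) ^ k * G :=
          mul_le_mul (pow_le_pow_of_le_one (by norm_num) (by norm_num)
            (Nat.le_mul_of_pos_right k hz.1)) (hG ⟨_, rfl⟩) (hρ _).le (by positivity)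
  have hlim : Tendsto (fun k : ℕ ↦ (1 / 2 : ℝ) ^ k * G) atTop (𝓝 0) := by
    simpa using (tendsto_pow_atTop_nhds_zero_of_lt_one (r := (1 / 2 : ℝ)) (by norm_num)
      (by norm_num)).mul_const G
  exact (hρ i₀).not_ge (ge_of_tendsto' hlim hbound)

theorem IsEscapeRadius.exists_isTrappingDomain_of_contractsDisc [NeZero q] [Finite ι]
    (hR : IsEscapeRadius p q c R) (hρ : ∀ i, 0 < ρ i)
    (hdisc : ∀ i, ContractsDisc p q c (nonescaping p q c R M)
      (y i) (ρ i) (y (next i)) (ρ (next i)))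
    (hcrit : c ∈ nonescaping p q c R M → ∃ i, c ∈ closedBall (y i) (ρ i))
    (hne : ∃ s ∈ (graph p q c).preimage^[M] (ball 0 R), ∀ i, s ∉ closedBall (y i) (ρ i)) :
    ∃ U ε R', IsTrappingDomain p q c U ε R' := by
  obtain ⟨s, hs, hsout⟩ := hne
  refine hR.exists_isTrappingDomain_of_absorbing (M := M)
    (B := ⋃ i, closedBall (y i) (ρ i)) (V := ⋃ i, ball (y i) (ρ i))
    (isClosed_iUnion_of_finite fun _ ↦ isClosed_closedBall) (isOpen_iUnion fun _ ↦ isOpen_ball)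
    (Set.iUnion_mono fun _ ↦ ball_subset_closedBall) ?_ ?_ ⟨s, hs, ?_⟩ ?_
  · intro z hz w hw h
    obtain ⟨i, hi⟩ := Set.mem_iUnion.1 hz
    exact Set.mem_iUnion.2 ⟨next i, (hdisc i z hi w hw h).1⟩
  · exact fun hc ↦ Set.mem_iUnion.2 (hcrit hc)
  · simpa only [Set.mem_iUnion, not_exists] using hsout
  · intro n z hz j hj hmem
    obtain ⟨i, hi⟩ := Set.mem_iUnion.1 hmem
    refine hz.notMem_of_contractsDisc (fun l ↦ ?_) hρ hdisc hj i hi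
    exact SetRel.preimage_mono.iterate M ball_subset_closedBall
      (hR.mem_iterate_preimage_ball_of_isRepellingCycle hz M l)

end AbsorbingDiscs

theorem exists_isImage_self (hpq : q < p) (c : ℂ) : ∃ z, IsImage p q c z z := by
  have hdeg : ((Polynomial.X - Polynomial.C c) ^ q).degree <
      (Polynomial.X ^ p : Polynomial ℂ).degree := by
    rw [Polynomial.degree_pow, Polynomial.degree_X_sub_C, Polynomial.degree_X_pow]
    simpa using hpq
  obtain ⟨z, hz⟩ := Complex.exists_root
    (f := Polynomial.X ^ p - (Polynomial.X - Polynomial.C c) ^ q) (by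
      rw [Polynomial.degree_sub_eq_left_of_degree_lt hdeg, Polynomial.degree_X_pow]
      exact_mod_cast q.zero_le.trans_lt hpq)
  simp only [Polynomial.IsRoot, Polynomial.eval_sub, Polynomial.eval_pow, Polynomial.eval_X,
    Polynomial.eval_C] at hz
  exact ⟨z, (sub_eq_zero.1 hz).symm⟩

theorem isImage_zero_left_iff [NeZero p] [NeZero q] {w : ℂ} : IsImage p q c 0 w ↔ w = c := by
  rw [IsImage, zero_pow (NeZero.ne p), pow_eq_zero_iff (NeZero.ne q), sub_eq_zero]

theorem exists_isImage_self_ne_zero [NeZero q] (hpq : q < p) (c : ℂ) :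
    ∃ z, IsImage p q c z z ∧ z ≠ 0 := by
  have : NeZero p := ⟨hpq.ne_bot⟩
  rcases eq_or_ne c 0 with rfl | hc
  · exact ⟨1, by simp [IsImage], one_ne_zero⟩
  · obtain ⟨z, hz⟩ := exists_isImage_self hpq c
    refine ⟨z, hz, ?_⟩
    rintro rfl
    exact hc (isImage_zero_left_iff.1 hz).symm

theorem exists_isTrappingDomain_of_notMem_boundedCriticalLocus [NeZero q] (hpq : q < p)
    (h : c ∉ boundedCriticalLocus p q) : ∃ U ε R, IsTrappingDomain p q c U ε R := by
  have : NeZero p := ⟨hpq.ne_bot⟩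
  obtain ⟨R, hRc⟩ := exists_eventually_isEscapeRadius (NeZero.ne q) hpq c
  have hR : IsEscapeRadius p q c R := hRc.self_of_nhds
  obtain ⟨M, hM⟩ : ∃ M, c ∉ nonescaping p q c R M := by
    by_contra! hall
    obtain ⟨x, hx, hx0, hb⟩ := hR.exists_isOrbit_isBounded hall
    refine h ⟨cons 0 x, hx.cons (isImage_zero_left_iff.2 hx0), rfl, ?_⟩
    refine (hb.insert 0).subset ?_
    rintro _ ⟨_ | i, rfl⟩
    · exact Set.mem_insert _ _
    · exact Set.mem_insert_of_mem _ (Set.mem_range_self i)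
  obtain ⟨s, hs⟩ := exists_isImage_self hpq c
  refine hR.exists_isTrappingDomain_of_absorbing (M := M) isClosed_empty isOpen_empty subset_rfl
    (by simp) (fun hc ↦ absurd hc hM) ⟨s, ?_, Set.notMem_empty s⟩ (by simp)
  exact hR.mem_iterate_preimage_ball (x := fun _ ↦ s) (fun _ ↦ hs) (by simp) M

end Correspondence

namespace Correspondence

variable {p q : ℕ} {a c y y' : ℂ} {R : ℝ} {M : ℕ}

/-! ### Absorbing discs near a simple centre -/

theorem IsImage.norm_sub_le_mul (hq : q ≠ 0) (hpq : q ≤ p) {z w : ℂ} {s : ℝ} (hs : 0 ≤ s)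
    (h : IsImage p q c z w) (hz : ‖z‖ ^ (p - q) ≤ s ^ q) : ‖w - c‖ ≤ s * ‖z‖ := by
  refine le_of_pow_le_pow_left₀ hq (by positivity) ?_
  calc ‖w - c‖ ^ q = ‖z‖ ^ (p - q) * ‖z‖ ^ q := by rw [h.norm_pow_eq, pow_sub_mul_pow _ hpq]
    _ ≤ s ^ q * ‖z‖ ^ q := by gcongr
    _ = (s * ‖z‖) ^ q := (mul_pow _ _ _).symm

theorem IsImage.norm_branchDeriv_le (hq : q ≠ 0) (hpq : q ≤ p) {z w : ℂ} {s : ℝ} (hs : 0 ≤ s)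
    (h : IsImage p q c z w) (hz : ‖z‖ ^ (p - q) ≤ s ^ q) :
    ‖branchDeriv p q c z w‖ ≤ p / q * s := by
  rw [branchDeriv, norm_div, norm_mul, norm_mul, Complex.norm_natCast, Complex.norm_natCast,
    mul_div_mul_comm]
  gcongr
  exact div_le_of_le_mul₀ (norm_nonneg _) hs (h.norm_sub_le_mul hq hpq hs hz)

theorem eventually_forall_isImage_dist_lt (hR : ∀ᶠ c in 𝓝 a, IsEscapeRadius p q c R)
    (huniq : ∀ w ∈ nonescaping p q a R M, IsImage p q a y w → w = y') {κ : ℝ} (hκ : 0 < κ) :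
    ∀ᶠ v : ℂ × ℂ in 𝓝 (a, y), ∀ w ∈ nonescaping p q v.1 R M, IsImage p q v.1 v.2 w →
      dist w y' < κ := by
  obtain ⟨C, hCa, hC, hCR⟩ := exists_mem_nhds_isClosed_subset hR
  have hfar : IsClosed {b : (ℂ × ℂ) × ℂ | (b.1.1 ∈ C ∧ b.2 ∈ nonescaping p q b.1.1 R M) ∧
      IsImage p q b.1.1 b.1.2 b.2 ∧ κ ≤ dist b.2 y'} :=
    ((isClosed_setOf_mem_nonescaping hC hCR M).preimage
      (f := fun b : (ℂ × ℂ) × ℂ ↦ (b.1.1, b.2)) (by fun_prop)).and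
      ((isClosed_eq (by fun_prop) (by fun_prop)).and (isClosed_le (by fun_prop) (by fun_prop)))
  have hproj := isClosed_setOf_exists_mem_of_isCompact (isCompact_closedBall (0 : ℂ) R) hfar
  have hnear := hproj.isOpen_compl.mem_nhds (x := (a, y)) (by
    rintro ⟨w, -, ⟨-, hw⟩, h, hge⟩
    simp only [huniq w hw h, dist_self] at hge
    exact hge.not_gt hκ)
  filter_upwards [hnear, continuous_fst.continuousAt.preimage_mem_nhds hCa] with v hv hvC w hw h
  by_contra! hge
  exact hv ⟨w, (hCR hvC).nonescaping_subset_closedBall M hw, ⟨hvC, hw⟩, h, hge⟩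

theorem exists_eventually_forall_isImage_dist_le (hq : q ≠ 0) (hpq : q ≤ p)
    (hR : ∀ᶠ c in 𝓝 a, IsEscapeRadius p q c R) (hy : IsImage p q a y y')
    (huniq : ∀ w ∈ nonescaping p q a R M, IsImage p q a y w → w = y') :
    ∃ L : ℝ, ∀ᶠ v : ℂ × ℂ in 𝓝 (a, y), ∀ w ∈ nonescaping p q v.1 R M, IsImage p q v.1 v.2 w →
      dist w y' ≤ L * dist v.2 y + dist v.1 a := by
  have hp : p ≠ 0 := (hq.bot_lt.trans_le hpq).ne'
  suffices h : ∃ L : ℝ, ∀ᶠ v : ℂ × ℂ in 𝓝 (a, y), ∀ w ∈ nonescaping p q v.1 R M,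
      IsImage p q v.1 v.2 w → dist (w - v.1) (y' - a) ≤ L * dist v.2 y by
    obtain ⟨L, hL⟩ := h
    refine ⟨L, hL.mono fun v hv w hw h ↦ ?_⟩
    have htriangle := dist_add_add_le (w - v.1) v.1 (y' - a) a
    rw [sub_add_cancel, sub_add_cancel] at htriangle
    linarith [hv w hw h]
  rcases eq_or_ne y 0 with rfl | hy0
  · have : NeZero p := ⟨hp⟩
    have : NeZero q := ⟨hq⟩
    obtain rfl := isImage_zero_left_iff.1 hy
    have hsmall : ∀ᶠ v : ℂ × ℂ in 𝓝 (y', 0), ‖v.2‖ < 1 :=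
      ContinuousAt.eventually_lt (by fun_prop) continuousAt_const (by simp)
    refine ⟨1, hsmall.mono fun v hv w _ h ↦ ?_⟩
    rw [sub_self, dist_zero_right, dist_zero_right]
    exact h.norm_sub_le_mul hq hpq zero_le_one (by simpa using pow_le_one₀ (norm_nonneg _) hv.le)
  · obtain ⟨L, hL⟩ := exists_eventually_dist_le_of_pow_eq hp hq hy0 hy
    obtain ⟨δ, hδ, hLδ⟩ := Metric.eventually_nhds_iff.1 hL
    have hnear : ∀ᶠ v : ℂ × ℂ in 𝓝 (a, y), dist v (a, y) < δ / 2 := ball_mem_nhds _ (half_pos hδ)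
    refine ⟨L, ?_⟩
    filter_upwards [eventually_forall_isImage_dist_lt hR huniq (half_pos hδ), hnear]
      with v hv hvδ w hw h
    rw [Prod.dist_eq, max_lt_iff] at hvδ
    refine hLδ (y := (v.2, w - v.1)) ?_ h
    rw [Prod.dist_eq, max_lt_iff]
    refine ⟨hvδ.2.trans (half_lt_self hδ), ?_⟩
    linarith [dist_sub_sub_le w v.1 y' a, hv w hw h, hvδ.1]

/-- The image disc has to be larger by a constant factor, which absorbs both the Lipschitz constant
and the derivative of the branches at `y`. -/
theorem eventually_contractsDisc_of_unique (hq : q ≠ 0) (hpq : q ≤ p)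
    (hR : ∀ᶠ c in 𝓝 a, IsEscapeRadius p q c R) (hy : IsImage p q a y y')
    (huniq : ∀ w ∈ nonescaping p q a R M, IsImage p q a y w → w = y') :
    ∀ᶠ Λ : ℝ in atTop, ∀ᶠ r in 𝓝[>] 0, ∀ c ∈ ball a r,
      ContractsDisc p q c (nonescaping p q c R M) y r y' (2 * Λ * r) := by
  obtain ⟨L, hL⟩ := exists_eventually_forall_isImage_dist_le hq hpq hR hy huniq
  set D : ℝ := (‖y‖ + 1) ^ (p - q)
  filter_upwards [eventually_ge_atTop L, eventually_gt_atTop 1, eventually_ge_atTop (p / q * D)]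
    with Λ hΛL hΛ1 hΛD
  filter_upwards [(eventually_closedBall_subset hL).filter_mono nhdsWithin_le_nhds,
    Ioc_mem_nhdsGT one_pos] with r hr hr1 c hc z hz w hw h
  rw [mem_ball] at hc
  rw [mem_closedBall] at hz
  have hdist : dist w y' ≤ L * dist z y + dist c a :=
    hr (by rw [mem_closedBall, Prod.dist_eq]; exact max_le hc.le hz : (c, z) ∈ closedBall (a, y) r)
      w hw h
  have hzy : ‖z‖ ≤ ‖y‖ + 1 := by
    linarith [norm_le_norm_add_norm_sub' z y, dist_eq_norm z y, hr1.2]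
  have hderiv : ‖branchDeriv p q c z w‖ ≤ p / q * D := by
    refine h.norm_branchDeriv_le hq hpq (by positivity) ?_
    calc ‖z‖ ^ (p - q) ≤ D := pow_le_pow_left₀ (norm_nonneg z) hzy _
      _ ≤ D ^ q := le_self_pow₀ (one_le_pow₀ (by linarith [norm_nonneg y])) hq
  have hLr : L * dist z y ≤ Λ * r := by gcongr
  have hrΛ : r < Λ * r := lt_mul_of_one_lt_left hr1.1 hΛ1
  refine ⟨mem_ball.2 (by linarith), ?_⟩
  calc ‖branchDeriv p q c z w‖ * r ≤ Λ * r := by gcongr; exacts [hr1.1.le, hderiv.trans hΛD]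
    _ = 2 * Λ * r / 2 := by ring

/-- At the critical point `0` the branches are superattracting, whence the arbitrary factor
`κ`. -/
theorem eventually_contractsDisc_zero (hq : q ≠ 0) (hpq : q < p) (a : ℂ) {κ : ℝ} (hκ : 0 < κ) :
    ∀ᶠ r in 𝓝[>] 0, ∀ c ∈ ball a (κ * r / 2), ∀ S, ContractsDisc p q c S 0 r a (κ * r) := by
  have hp : 0 < p := q.zero_le.trans_lt hpq
  have hβ : (1 : ℝ) ≤ p / q := by
    rw [one_le_div (by positivity)]
    exact_mod_cast hpq.le
  set τ : ℝ := κ / (2 * (p / q))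
  have hτ : 0 < τ := by positivity
  have hτκ : p / q * τ = κ / 2 := by simp only [τ]; field_simp
  have hsmall : ∀ᶠ r : ℝ in 𝓝[>] 0, r ^ (p - q) < τ ^ q :=
    (ContinuousAt.eventually_lt (by fun_prop) continuousAt_const
      (by simp [(Nat.sub_pos_of_lt hpq).ne', hτ])).filter_mono nhdsWithin_le_nhds
  filter_upwards [hsmall, self_mem_nhdsWithin] with r hr (hr0 : 0 < r) c hc S z hz w _ h
  rw [mem_closedBall_zero_iff] at hz
  have hzτ : ‖z‖ ^ (p - q) ≤ τ ^ q := (pow_le_pow_left₀ (norm_nonneg _) hz _).trans hr.le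
  constructor
  · have hwc : dist w c ≤ κ / 2 * r :=
      calc dist w c ≤ τ * ‖z‖ := by
            rw [dist_eq_norm]
            exact h.norm_sub_le_mul hq hpq.le hτ.le hzτ
        _ ≤ p / q * τ * r := by gcongr; exact le_mul_of_one_le_left hτ.le hβ
        _ = κ / 2 * r := by rw [hτκ]
    rw [mem_ball] at hc ⊢
    linarith [dist_triangle w c a]
  · calc ‖branchDeriv p q c z w‖ * r ≤ p / q * τ * r := by
          gcongr
          exact h.norm_branchDeriv_le hq hpq.le hτ.le hzτ
      _ = κ * r / 2 := by rw [hτκ]; ring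

theorem exists_eventually_forall_contractsDisc (hq : q ≠ 0) (hpq : q < p)
    (hR : ∀ᶠ c in 𝓝 a, IsEscapeRadius p q c R) {y : ℕ → ℂ} {m : ℕ} (hya : y 0 = a)
    (hy0 : y m = 0) (hy : ∀ i < m, IsImage p q a (y i) (y (i + 1)))
    (huniq : ∀ i < m, ∀ w ∈ nonescaping p q a R M, IsImage p q a (y i) w → w = y (i + 1)) :
    ∃ Λ > (0 : ℝ), ∀ᶠ s in 𝓝[>] 0, ∀ c ∈ ball a (s / 2), ∀ i : Fin (m + 1),
      ContractsDisc p q c (nonescaping p q c R M) (y i) (s * Λ ^ (i : ℕ))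
        (y (i + 1 : Fin (m + 1))) (s * Λ ^ ((i + 1 : Fin (m + 1)) : ℕ)) := by
  obtain ⟨Λ, hΛ, hΛ1⟩ : ∃ Λ : ℝ, (∀ i ∈ Set.Iio m, ∀ᶠ r in 𝓝[>] 0, ∀ c ∈ ball a r,
      ContractsDisc p q c (nonescaping p q c R M) (y i) r (y (i + 1)) (2 * Λ * r)) ∧ 1 < Λ :=
    (((eventually_all_finite (Set.finite_Iio m)).2 fun i hi ↦
      eventually_contractsDisc_of_unique hq hpq.le hR (hy i hi) (huniq i hi)).and
        (eventually_gt_atTop 1)).exists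
  have hΛ1 : 1 ≤ 2 * Λ := by linarith
  have hscale (k : ℕ) : Tendsto (fun s : ℝ ↦ s * (2 * Λ) ^ k) (𝓝[>] 0) (𝓝[>] 0) := by
    have hpos : 0 < (2 * Λ) ^ k := by positivity
    refine tendsto_nhdsWithin_iff.2 ⟨?_, ?_⟩
    · have hcont : Continuous fun s : ℝ ↦ s * (2 * Λ) ^ k := by fun_prop
      exact (hcont.tendsto' _ _ (zero_mul _)).mono_left nhdsWithin_le_nhds
    · filter_upwards [self_mem_nhdsWithin] with s hs using mul_pos hs hpos
  have hcrit := (hscale m).eventually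
    (eventually_contractsDisc_zero hq hpq a (κ := ((2 * Λ) ^ m)⁻¹) (by positivity))
  have hother : ∀ᶠ s : ℝ in 𝓝[>] 0, ∀ i ∈ Set.Iio m, ∀ c ∈ ball a (s * (2 * Λ) ^ i),
      ContractsDisc p q c (nonescaping p q c R M) (y i) (s * (2 * Λ) ^ i) (y (i + 1))
        (2 * Λ * (s * (2 * Λ) ^ i)) :=
    (eventually_all_finite (Set.finite_Iio m)).2 fun i hi ↦ (hscale i).eventually (hΛ i hi)
  refine ⟨2 * Λ, by linarith, ?_⟩
  filter_upwards [hcrit, hother, self_mem_nhdsWithin] with s hs0 hs (hspos : 0 < s) c hc i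
  have hunscale : ((2 * Λ) ^ m)⁻¹ * (s * (2 * Λ) ^ m) = s := by field_simp
  induction i using Fin.lastCases with
  | last => simpa [hy0, hya] using (hunscale ▸ hs0) c hc _
  | cast i =>
    have hci : c ∈ ball a (s * (2 * Λ) ^ (i : ℕ)) := by
      refine ball_subset_ball ?_ hc
      linarith [le_mul_of_one_le_right hspos.le (one_le_pow₀ hΛ1 (n := i))]
    rw [Fin.coeSucc_eq_succ, Fin.val_succ, Fin.val_castSucc, pow_succ', mul_left_comm]
    exact hs i i.2 c hci

theorem finite_setOf_isImage [NeZero q] (c z : ℂ) : {w | IsImage p q c z w}.Finite := by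
  refine ((Polynomial.nthRoots q (z ^ p)).toFinset.finite_toSet.image fun u ↦ u + c).subset ?_
  intro w hw
  refine ⟨w - c, ?_, by ring⟩
  rwa [Finset.mem_coe, Multiset.mem_toFinset, Polynomial.mem_nthRoots (NeZero.pos q)]

theorem IsOrbit.append {z x : ℕ → ℂ} (hz : IsOrbit p q c z) (hx : IsOrbit p q c x) {i : ℕ}
    (h : IsImage p q c (z i) (x 0)) :
    IsOrbit p q c fun j ↦ if j ≤ i then z j else x (j - (i + 1)) := by
  intro j
  rcases lt_trichotomy j i with hj | rfl | hj
  · simpa [hj.le, Nat.succ_le_of_lt hj] using hz j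
  · simpa using h
  · simpa [hj.not_ge, (hj.trans j.lt_succ_self).not_ge, Nat.succ_sub (Nat.succ_le_of_lt hj)]
      using hx (j - (i + 1))

theorem not_tendsto_cobounded_of_isBounded {x : ℕ → ℂ}
    (hb : Bornology.IsBounded (Set.range x)) : ¬ Tendsto x atTop (Bornology.cobounded ℂ) := by
  intro h
  obtain ⟨i, hi⟩ := (h.eventually (Bornology.isBounded_def.1 hb)).exists
  exact hi (Set.mem_range_self i)

theorem IsSimpleCentre.exists_periodic_orbit (ha : IsSimpleCentre p q a) :
    ∃ (z : ℕ → ℂ) (n : ℕ), 0 < n ∧ IsOrbit p q a z ∧ z 0 = 0 ∧ Function.Periodic z n ∧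
      ∀ i x, IsOrbit p q a x → IsImage p q a (z i) (x 0) → Bornology.IsBounded (Set.range x) →
        ∀ j, x j = z (i + 1 + j) := by
  obtain ⟨z, hz, hz0, ⟨n, hn, hper⟩, hesc⟩ := ha
  have hzb : Bornology.IsBounded (Set.range z) := by
    simpa only [hper.map_mod_nat] using isBounded_range_mod hn z
  refine ⟨z, n, hn, hz, hz0, hper, fun i x hx h hb j ↦ ?_⟩
  set w : ℕ → ℂ := fun j ↦ if j ≤ i then z j else x (j - (i + 1)) with hw
  have hwb : Bornology.IsBounded (Set.range w) := by
    refine (hzb.union hb).subset ?_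
    rintro _ ⟨j, rfl⟩
    by_cases hj : j ≤ i <;> simp [hw, hj]
  have hwz : w = z := by
    by_contra hne
    exact not_tendsto_cobounded_of_isBounded hwb
      (hesc w (hz.append hx h) (by simpa [hw] using hz0) hne)
  rw [← hwz]
  simp [hw, show ¬i + 1 + j ≤ i by lia]

theorem IsEscapeRadius.eventually_eq_of_mem_nonescaping [NeZero q] (hR : IsEscapeRadius p q c R)
    (h : ∀ x, IsOrbit p q c x → IsImage p q c y (x 0) → Bornology.IsBounded (Set.range x) →
      x 0 = y') :
    ∀ᶠ M in atTop, ∀ w ∈ nonescaping p q c R M, IsImage p q c y w → w = y' := by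
  have hall : ∀ᶠ M in atTop, ∀ w ∈ {w | IsImage p q c y w}, w ∈ nonescaping p q c R M → w = y' := by
    refine (eventually_all_finite (finite_setOf_isImage c y)).2 fun w hw ↦ ?_
    by_cases hesc : ∃ N, w ∉ nonescaping p q c R N
    · obtain ⟨N, hN⟩ := hesc
      filter_upwards [eventually_ge_atTop N] with M hM hwM
      exact absurd (hR.antitone_nonescaping hM hwM) hN
    · obtain ⟨x, hx, rfl, hb⟩ := hR.exists_isOrbit_isBounded (not_exists_not.1 hesc)
      exact Eventually.of_forall fun _ _ ↦ h x hx hw hb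
  exact hall.mono fun M hM w hw him ↦ hM w him hw

theorem IsSimpleCentre.eventually_exists_isTrappingDomain [NeZero q] (hpq : q < p)
    (ha : IsSimpleCentre p q a) : ∀ᶠ c in 𝓝 a, ∃ U ε R, IsTrappingDomain p q c U ε R := by
  have : NeZero p := ⟨hpq.ne_bot⟩
  obtain ⟨z, n, hn, hz, hz0, hper, hbdd⟩ := ha.exists_periodic_orbit
  obtain ⟨m, rfl⟩ := Nat.exists_eq_succ_of_ne_zero hn.ne'
  obtain ⟨R, hR⟩ := exists_eventually_isEscapeRadius (NeZero.ne q) hpq a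
  obtain ⟨M, hM⟩ : ∃ M, ∀ i ∈ Set.Iio m, ∀ w ∈ nonescaping p q a R M,
      IsImage p q a (z (i + 1)) w → w = z (i + 1 + 1) :=
    ((eventually_all_finite (Set.finite_Iio m)).2 fun i _ ↦
      hR.self_of_nhds.eventually_eq_of_mem_nonescaping fun x hx h hb ↦
        hbdd (i + 1) x hx h hb 0).exists
  have hza : z 1 = a := isImage_zero_left_iff.1 (hz0 ▸ hz 0)
  have hzm : z (m + 1) = 0 := by simpa [hz0] using hper 0
  obtain ⟨Λ, hΛ, hdisc⟩ := exists_eventually_forall_contractsDisc (NeZero.ne q) hpq hR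
    (y := fun i ↦ z (i + 1)) hza hzm (fun i _ ↦ hz (i + 1)) hM
  obtain ⟨s₀, hs₀, hs₀ne⟩ := exists_isImage_self_ne_zero hpq a
  have hs₀z (i : ℕ) : s₀ ≠ z i := by
    rintro rfl
    have hconst := hbdd i (fun _ ↦ z i) (fun _ ↦ hs₀) hs₀ (by simp) (i * m + m)
    have hmul : z ((i + 1) * (m + 1)) = 0 := by simpa [hz0] using hper.nat_mul (i + 1) 0
    rw [show i + 1 + (i * m + m) = (i + 1) * (m + 1) by ring, hmul] at hconst
    exact hs₀ne hconst
  have hsmall : ∀ᶠ s : ℝ in 𝓝[>] 0, ∀ i : Fin (m + 1), s * Λ ^ (i : ℕ) < dist s₀ (z (i + 1)) :=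
    (eventually_all.2 fun i ↦ ContinuousAt.eventually_lt (by fun_prop) continuousAt_const
      (by simpa using hs₀z _)).filter_mono nhdsWithin_le_nhds
  obtain ⟨s, hs, hsmall, hspos : 0 < s⟩ := (hdisc.and (hsmall.and self_mem_nhdsWithin)).exists
  have hs₀M : ∀ᶠ c in 𝓝 a, s₀ ∈ (graph p q c).preimage^[M] (ball 0 R) :=
    ((isOpen_setOf_mem_iterate_preimage isOpen_ball M).preimage (f := fun c : ℂ ↦ (c, s₀))
      (by fun_prop)).mem_nhds
      (hR.self_of_nhds.mem_iterate_preimage_ball (x := fun _ ↦ s₀) (fun _ ↦ hs₀) (by simp) M)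
  filter_upwards [hR, hs₀M, ball_mem_nhds a (half_pos hspos)] with c hRc hs₀c hc
  refine hRc.exists_isTrappingDomain_of_contractsDisc (fun _ ↦ by positivity) (hs c hc)
    (fun _ ↦ ⟨0, ?_⟩) ⟨s₀, hs₀c, fun i hi ↦ (hsmall i).not_ge hi⟩
  simpa [hza] using (mem_ball.1 hc).le.trans (half_le_self hspos.le)

end Correspondence

theorem mainTheorem3_general (p q : ℕ) (hq : q ≠ 0) (hpq : q < p) :
    (∀ a : ℂ, Correspondence.IsSimpleCentre p q a →
      ∀ᶠ c in 𝓝 a, ∃ t : ℝ, Correspondence.IsBowenParameter p q c t ∧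
        dimH (Correspondence.juliaSet p q c) ≤ ENNReal.ofReal t) ∧
    (∀ c : ℂ, (∀ z : ℕ → ℂ, Correspondence.IsOrbit p q c z → z 0 = 0 →
        Tendsto z atTop (Bornology.cobounded ℂ)) →
      ∃ t : ℝ, Correspondence.IsBowenParameter p q c t ∧
        dimH (Correspondence.juliaSet p q c) ≤ ENNReal.ofReal t) ∧
    (∀ c : ℂ, c ∉ Correspondence.boundedCriticalLocus p q →
      ∃ t : ℝ, Correspondence.IsBowenParameter p q c t ∧
        dimH (Correspondence.juliaSet p q c) ≤ ENNReal.ofReal t) := by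
  have : NeZero q := ⟨hq⟩
  have : NeZero p := ⟨hpq.ne_bot⟩
  have hp : 1 < p := (Nat.one_le_iff_ne_zero.2 hq).trans_lt hpq
  have hescape (c : ℂ) (hc : c ∉ Correspondence.boundedCriticalLocus p q) :
      ∃ t : ℝ, Correspondence.IsBowenParameter p q c t ∧
        dimH (Correspondence.juliaSet p q c) ≤ ENNReal.ofReal t := by
    obtain ⟨U, ε, R, hU⟩ :=
      Correspondence.exists_isTrappingDomain_of_notMem_boundedCriticalLocus hpq hc
    exact hU.exists_isBowenParameter hp
  refine ⟨fun a ha ↦ ?_, fun c hc ↦ hescape c ?_, hescape⟩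
  · filter_upwards [ha.eventually_exists_isTrappingDomain hpq] with c ⟨U, ε, R, hU⟩
    exact hU.exists_isBowenParameter hp
  · rintro ⟨z, hz, hz0, hb⟩
    exact Correspondence.not_tendsto_cobounded_of_isBounded hb (hc z hz hz0)

theorem mainTheorem3 (p q : ℕ) (hq : 2 ≤ q) (hpq : q < p) :
    (∀ a : ℂ, Correspondence.IsSimpleCentre p q a →
      ∀ᶠ c in 𝓝 a, ∃ t : ℝ, Correspondence.IsBowenParameter p q c t ∧
        dimH (Correspondence.juliaSet p q c) ≤ ENNReal.ofReal t) ∧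
    (∀ c : ℂ, (∀ z : ℕ → ℂ, Correspondence.IsOrbit p q c z → z 0 = 0 →
        Tendsto z atTop (Bornology.cobounded ℂ)) →
      ∃ t : ℝ, Correspondence.IsBowenParameter p q c t ∧
        dimH (Correspondence.juliaSet p q c) ≤ ENNReal.ofReal t) ∧
    (∀ c : ℂ, c ∉ Correspondence.boundedCriticalLocus p q →
      ∃ t : ℝ, Correspondence.IsBowenParameter p q c t ∧
        dimH (Correspondence.juliaSet p q c) ≤ ENNReal.ofReal t) :=
  mainTheorem3_general p q (by omega) hpq
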